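/- Let $\mathcal T$ be an unrooted proper binary tree (every node has degree $1$ or $3$) embedded in the plane, with $n$ leaves, $m$ of which are marked. Suppose that each marked leaf $\ell$ is associated with a neighborhood $nh(\ell)$, a subtree of $\mathcal T$ rooted at (that is, containing) $\ell$, and that any two distinct marked leaves that are consecutive among the marked leaves in the cyclic topological ordering of the leaves of $\mathcal T$ have disjoint neighborhoods. Then there is a set $S$ of at least $\frac{1}{10}m$ marked leaves whose neighborhoods are pairwise disjoint and such that no edge of $\mathcal T$ has its endpoints in the neighborhoods of two different leaves of $S$. Further, at least a fraction $p$ of these $\frac{1}{10}m$ leaves can be selected in time $O\!\left(\frac{1}{1-p}n\right)$ for any $p\in(0,1)$. That is, there are a single algorithm (a unit-cost real RAM program with additions, subtractions and comparisons only) and an absolute constant $C$ with the following property. The input consists of the plane tree $\mathcal T$, stored by the counterclockwise lists of neighbors of its nodes together with the marks, of the neighborhoods, each stored as a linked tree entered at its leaf, and of a real number $p\in(0,1)$. For every $\mathcal T$ as above and every way of storing it there is a set $S$ as above such that, for every $p\in(0,1)$, the algorithm halts after at most $C\,\frac{n}{1-p}$ steps and returns a subset of $S$ with at least $p\cdot\frac{m}{10}$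 elements. -/

import Mathlib

/-! ### Plane binary trees with marked leaves and neighborhoods -/

/-- An unrooted proper binary tree embedded in the plane: a tree in which every node has degree
`1` (leaves) or `3`, with the embedding given combinatorially by a rotation system: `rot v` sends
each neighbor of `v` to the next neighbor of `v` in counterclockwise order around `v`
(its values at non-neighbors of `v` play no role). -/
structure PlaneBinaryTree (V : Type*) where
  graph : SimpleGraph V
  isTree : graph.IsTree
  proper : ∀ v, (graph.neighborSet v).ncard = 1 ∨ (graph.neighborSet v).ncard = 3
  rot : V → Equiv.Perm V
  rot_isCycleOn : ∀ v, (rot v).IsCycleOn (graph.neighborSet v)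

namespace PlaneBinaryTree

variable {V : Type*}

/-- The leaves: the nodes of degree one. -/
def leaves (T : PlaneBinaryTree V) : Set V :=
  {v | (T.graph.neighborSet v).ncard = 1}

/-- One step of the walk around the tree (with the tree on the left-hand side). The walk
is at `d.1` and about to traverse the edge from `d.1` to `d.2`; having arrived at `d.2` it is about
to leave along the next edge, in counterclockwise order around `d.2`, after the one it came from. -/
def contourStep (T : PlaneBinaryTree V) (d : V × V) : V × V :=
  (d.2, T.rot d.2 d.1)

/-- `a` and `b` belong to `M`, and `b` is the first element of `M` met, after
the start, by the walk around the tree that starts at the leaf `a`. For a set `M` of leaves this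
says that `b` follows `a` in the (cyclic) topological ordering of `M`. -/
def Follows (T : PlaneBinaryTree V) (M : Finset V) (a b : V) : Prop :=
  a ∈ M ∧ b ∈ M ∧ ∃ w, T.graph.Adj a w ∧ ∃ k : ℕ, 0 < k ∧
    (T.contourStep^[k] (a, w)).1 = b ∧
    ∀ j : ℕ, 0 < j → j < k → (T.contourStep^[j] (a, w)).1 ∉ M

end PlaneBinaryTree

/-- A marked tree: a plane binary tree, some of whose leaves are marked, where each marked leaf
`ℓ` has a neighborhood `nh ℓ`, a subtree (given by its set of nodes) that contains `ℓ`, such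
that consecutive marked leaves have disjoint neighborhoods. The values of `nh` at nodes that are
not marked play no role. -/
structure MarkedTree (V : Type*) extends PlaneBinaryTree V where
  marked : Finset V
  marked_leaf : ∀ l ∈ marked, l ∈ toPlaneBinaryTree.leaves
  nh : V → Set V
  mem_nh : ∀ l ∈ marked, l ∈ nh l
  nh_connected : ∀ l ∈ marked, (graph.induce (nh l)).Connected
  nh_disjoint : ∀ a b, toPlaneBinaryTree.Follows marked a b → a ≠ b → Disjoint (nh a) (nh b)

namespace MarkedTree

variable {V : Type*}

/-- `S` is a set of marked leaves with pairwise disjoint neighborhoods such that no tree edge has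
its endpoints in the neighborhoods of two different elements of `S`. -/
def IsSelection (T : MarkedTree V) (S : Finset V) : Prop :=
  S ⊆ T.marked ∧ ∀ a ∈ S, ∀ b ∈ S, a ≠ b →
    Disjoint (T.nh a) (T.nh b) ∧ ∀ x ∈ T.nh a, ∀ y ∈ T.nh b, ¬ T.graph.Adj x y

end MarkedTree

/-! ### A random access machine with a step count

The unit-cost real RAM, presented through structured programs: finitely many natural-number
variables, finitely many arrays of natural numbers (addressed indirectly), and finitely many real
variables. The arithmetic operations are addition and subtraction only; there is no
multiplication, no division and no rounding. -/

namespace RAM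

/-- Machine states: the natural-number variables, the arrays (`arr a i` is cell `i` of the
array `a`), and the real variables. A program mentions only finitely many variables and
arrays. -/
structure State where
  reg : ℕ → ℕ
  arr : ℕ → ℕ → ℕ
  real : ℕ → ℝ

/-- Natural-number expressions; subtraction is truncated. -/
inductive NatExp where
  | const (c : ℕ)
  | var (x : ℕ)
  | read (a : ℕ) (i : NatExp)
  | add (e f : NatExp)
  | sub (e f : NatExp)

/-- Real expressions. -/
inductive RealExp where
  | const (c : ℕ)
  | var (x : ℕ)
  | add (e f : RealExp)
  | sub (e f : RealExp)

/-- Tests. -/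
inductive Test where
  | le (e f : NatExp)
  | eq (e f : NatExp)
  | realLe (e f : RealExp)
  | not (t : Test)
  | and (t u : Test)

/-- Programs. -/
inductive Prog where
  | skip
  | assign (x : ℕ) (e : NatExp)
  | write (a : ℕ) (i e : NatExp)
  | assignReal (x : ℕ) (e : RealExp)
  | seq (c d : Prog)
  | ite (t : Test) (c d : Prog)
  | loop (t : Test) (c : Prog)

def NatExp.eval (s : State) : NatExp → ℕ
  | .const c => c
  | .var x => s.reg x
  | .read a i => s.arr a (i.eval s)
  | .add e f => e.eval s + f.eval s
  | .sub e f => e.eval s - f.eval s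

/-- The number of elementary operations in the evaluation of an expression. -/
def NatExp.cost : NatExp → ℕ
  | .const _ => 1
  | .var _ => 1
  | .read _ i => i.cost + 1
  | .add e f => e.cost + f.cost + 1
  | .sub e f => e.cost + f.cost + 1

noncomputable def RealExp.eval (s : State) : RealExp → ℝ
  | .const c => (c : ℝ)
  | .var x => s.real x
  | .add e f => e.eval s + f.eval s
  | .sub e f => e.eval s - f.eval s

def RealExp.cost : RealExp → ℕ
  | .const _ => 1
  | .var _ => 1
  | .add e f => e.cost + f.cost + 1
  | .sub e f => e.cost + f.cost + 1

def Test.holds (s : State) : Test → Prop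
  | .le e f => e.eval s ≤ f.eval s
  | .eq e f => e.eval s = f.eval s
  | .realLe e f => e.eval s ≤ f.eval s
  | .not t => ¬ t.holds s
  | .and t u => t.holds s ∧ u.holds s

def Test.cost : Test → ℕ
  | .le e f => e.cost + f.cost + 1
  | .eq e f => e.cost + f.cost + 1
  | .realLe e f => e.cost + f.cost + 1
  | .not t => t.cost + 1
  | .and t u => t.cost + u.cost + 1

def State.setReg (s : State) (x v : ℕ) : State :=
  { s with reg := Function.update s.reg x v }

def State.setArr (s : State) (a i v : ℕ) : State :=
  { s with arr := Function.update s.arr a (Function.update (s.arr a) i v) }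

noncomputable def State.setReal (s : State) (x : ℕ) (v : ℝ) : State :=
  { s with real := Function.update s.real x v }

/-- `Exec c s k s'`: started in the state `s`, the program `c` halts after exactly `k` steps, in
the state `s'`. -/
inductive Exec : Prog → State → ℕ → State → Prop where
  | skip (s : State) : Exec .skip s 1 s
  | assign (s : State) (x : ℕ) (e : NatExp) :
      Exec (.assign x e) s (e.cost + 1) (s.setReg x (e.eval s))
  | write (s : State) (a : ℕ) (i e : NatExp) :
      Exec (.write a i e) s (i.cost + e.cost + 1) (s.setArr a (i.eval s) (e.eval s))
  | assignReal (s : State) (x : ℕ) (e : RealExp) :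
      Exec (.assignReal x e) s (e.cost + 1) (s.setReal x (e.eval s))
  | seq {c d : Prog} {s s' s'' : State} {k k' : ℕ} :
      Exec c s k s' → Exec d s' k' s'' → Exec (.seq c d) s (k + k') s''
  | iteTrue {t : Test} {c d : Prog} {s s' : State} {k : ℕ} :
      t.holds s → Exec c s k s' → Exec (.ite t c d) s (t.cost + k) s'
  | iteFalse {t : Test} {c d : Prog} {s s' : State} {k : ℕ} :
      ¬ t.holds s → Exec d s k s' → Exec (.ite t c d) s (t.cost + k) s'
  | loopDone {t : Test} {c : Prog} {s : State} :
      ¬ t.holds s → Exec (.loop t c) s t.cost s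
  | loopStep {t : Test} {c : Prog} {s s' s'' : State} {k k' : ℕ} :
      t.holds s → Exec c s k s' → Exec (.loop t c) s' k' s'' →
      Exec (.loop t c) s (t.cost + k + k') s''

/-! ### Input and output -/

/-- The arrays `arr` store the marked tree `T` with nodes `0, …, N - 1`.

* Array `0` holds the degree of each node, and arrays `1`, `2`, `3` its neighbors in
  counterclockwise order, from an arbitrary first one (at a leaf, three times its only neighbor).
* Array `4` tells which nodes are marked.
* Each neighborhood is stored separately, as a linked tree that can be
  entered only at its leaf: the record of `v` in `nh l` has an arbitrary address `h l v`,
  array `5` holds the address of the record of `l` in `nh l`, array `6` holds the node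
  to which a record belongs, and array `7 + i` holds the link from the record of `v` to the record
  of the neighbor of `v` stored in array `1 + i`: its address plus one, or `0` (no link) if that
  neighbor is not in `nh l`.
* All arrays from number `10` on are filled with zeros. All other cells are arbitrary. -/
structure Stores {N : ℕ} (T : MarkedTree (Fin N)) (arr : ℕ → ℕ → ℕ)
    (h : Fin N → Fin N → ℕ) : Prop where
  degree : ∀ v : Fin N, arr 0 v = (T.graph.neighborSet v).ncard
  nbr : ∀ v : Fin N, ∃ w : Fin N, T.graph.Adj v w ∧
    arr 1 v = w ∧ arr 2 v = T.rot v w ∧ arr 3 v = T.rot v (T.rot v w)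
  marked : ∀ v : Fin N, (v ∈ T.marked → arr 4 v = 1) ∧ (v ∉ T.marked → arr 4 v = 0)
  root : ∀ l ∈ T.marked, arr 5 l = h l l
  node : ∀ l ∈ T.marked, ∀ v ∈ T.nh l, arr 6 (h l v) = v
  link : ∀ l ∈ T.marked, ∀ v ∈ T.nh l, ∀ i < 3, ∀ w : Fin N, arr (1 + i) v = w →
    (w ∈ T.nh l → arr (7 + i) (h l v) = h l w + 1) ∧ (w ∉ T.nh l → arr (7 + i) (h l v) = 0)
  zero : ∀ a ≥ 10, ∀ i, arr a i = 0

/-- The initial state: the number of nodes is in the natural-number variable `0`, the parameter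
`p` is in the real variable `0`, and all other variables are zero. -/
noncomputable def initial (N : ℕ) (p : ℝ) (arr : ℕ → ℕ → ℕ) : State where
  reg := Function.update 0 0 N
  arr := arr
  real := Function.update 0 0 p

/-- The set of nodes returned in a final state: those with a nonzero entry in array `10`. -/
def output (N : ℕ) (s : State) : Finset (Fin N) :=
  Finset.univ.filter fun v => s.arr 10 v ≠ 0

end RAM

/-! ### Rooted views of a plane binary tree -/

/-! Root the tree at a leaf. A rooted subtree is joined to the rest by a single edge
(`Rooted.boundary`), and its marked leaves form a run of the cyclic order. Neighborhoods are
connected, so if `l` lies below a child of `v` and `v ∉ nh l`, then all of `nh l` stays below that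
child.

A bottom-up sweep selects leaves. When two subtrees with one marked leaf each meet at `v`, these
leaves are consecutive, so at least one of the two neighborhoods misses `v`, and such a leaf is
selected. Later a single leaf `l` may arrive at `v` on one side of a subtree in which something is
already selected. If `nh l` misses `v`, then `l` is selected; otherwise it becomes pending on its
side. Let three such leaves in succession on one side, from bottom to top, be `l₁`, `l₂`, `l₃`. The
neighborhood of `l₁` contains the node at which `l₁` arrived, and this node separates the earlier
selection from everything above. Since `nh l₂` is disjoint from `nh l₁`, it cannot pass that node
and is apart from the selection. Since `nh l₃` contains the node at which `l₃` arrives, `nh l₂`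
misses that node and stays below it. So `l₂` can be selected (`push_spec`), and at most two leaves
per side are ever pending.

The count in `status_spec` is the invariant `#marked + 8 ≤ 10 * #selected + #pending`. The first
selection accounts for two marked leaves, and `2 + 8 = 10`. When two nontrivial subtrees merge,
their at most `4 + 4` pending leaves are dropped, which uses up one of the two summands `8`. Both
cases are tight.

The algorithm performs this sweep along the walk around the tree, with bounded work per visit
(`Stores.rounds`). Membership `v ∈ nh l` is tested with a pointer into the stored neighborhood that
climbs one link per level. The whole selection is returned in linear time; as `1 / (1 - p) ≥ 1`,
this serves every `p`. -/

/-- Binary trees with labelled nodes. -/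
inductive BinTree (V : Type*) where
  | leaf (v : V)
  | node (v : V) (a b : BinTree V)

namespace BinTree

variable {V : Type*}

def root : BinTree V → V
  | leaf v => v
  | node v _ _ => v

def support : BinTree V → Set V
  | leaf v => {v}
  | node v a b => insert v (a.support ∪ b.support)

/-- The labels met by a walk around the tree, one entry for each visit. -/
def tour : BinTree V → List V
  | leaf v => [v]
  | node v a b => v :: (a.tour ++ v :: (b.tour ++ [v]))

/-- The labels of the leaves, from left to right. -/
def fringe : BinTree V → List V
  | leaf v => [v]
  | node _ a b => a.fringe ++ b.fringe

theorem root_mem_support (t : BinTree V) : t.root ∈ t.support := by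
  cases t <;> simp [root, support]

theorem mem_support_of_mem_fringe {t : BinTree V} {x : V} (h : x ∈ t.fringe) : x ∈ t.support := by
  induction t with
  | leaf v => simpa [fringe, support] using h
  | node v a b iha ihb =>
    rcases List.mem_append.1 h with h | h
    · exact .inr (.inl (iha h))
    · exact .inr (.inr (ihb h))

theorem mem_tour {t : BinTree V} {x : V} : x ∈ t.tour ↔ x ∈ t.support := by
  induction t with
  | leaf v => simp [tour, support]
  | node v a b iha ihb => simp [tour, support, iha, ihb]; tauto

/-- With `n` leaves there are `n - 1` inner nodes, each visited three times: `n + 3 * (n - 1) = 4 *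
n - 3`. -/
theorem length_tour_add_three_le (t : BinTree V) : t.tour.length + 3 ≤ 4 * t.fringe.length := by
  induction t with
  | leaf v => simp [tour, fringe]
  | node v a b iha ihb => simp [tour, fringe]; omega

end BinTree

/-! ### Rotations, rooted subtrees and their separation from the rest of the tree -/

namespace PlaneBinaryTree

variable {V : Type*}

theorem finite_neighborSet (T : PlaneBinaryTree V) (v : V) : (T.graph.neighborSet v).Finite := by
  refine Set.finite_of_ncard_pos ?_
  rcases T.proper v with h | h <;> omega

theorem adj_rot (T : PlaneBinaryTree V) {u v : V} (h : T.graph.Adj v u) :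
    T.graph.Adj v (T.rot v u) :=
  ((T.rot_isCycleOn v).apply_mem_iff (x := u)).2 h

theorem eq_of_adj_of_leaf (T : PlaneBinaryTree V) {u v w : V}
    (hv : (T.graph.neighborSet v).ncard = 1) (hu : T.graph.Adj v u) (hw : T.graph.Adj v w) :
    w = u := by
  obtain ⟨x, hx⟩ := Set.ncard_eq_one.1 hv
  have h1 : u ∈ T.graph.neighborSet v := hu
  have h2 : w ∈ T.graph.neighborSet v := hw
  rw [hx] at h1 h2
  exact h2.trans h1.symm

theorem rot_leaf (T : PlaneBinaryTree V) {u v : V}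
    (hv : (T.graph.neighborSet v).ncard = 1) (hu : T.graph.Adj v u) : T.rot v u = u :=
  T.eq_of_adj_of_leaf hv hu (T.adj_rot hu)

/-- The rotation at a node of degree three. -/
theorem rot_node (T : PlaneBinaryTree V) {u v : V}
    (hv : (T.graph.neighborSet v).ncard = 3) (hu : T.graph.Adj v u) :
    T.rot v u ≠ u ∧ T.rot v (T.rot v u) ≠ u ∧ T.rot v (T.rot v (T.rot v u)) = u ∧
      ∀ w, T.graph.Adj v w → w = u ∨ w = T.rot v u ∨ w = T.rot v (T.rot v u) := by
  obtain ⟨s, hs⟩ := (T.finite_neighborSet v).exists_finset_coe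
  have hc : (T.rot v).IsCycleOn (s : Set V) := hs ▸ T.rot_isCycleOn v
  have hcard : s.card = 3 := by rw [← hs, Set.ncard_coe_finset] at hv; exact hv
  have hmem : ∀ w, w ∈ s ↔ T.graph.Adj v w := fun w => by
    rw [← Finset.mem_coe, hs]; rfl
  have hus := (hmem u).2 hu
  have key : ∀ n : ℕ, ((T.rot v) ^ n) u = u ↔ 3 ∣ n := fun n => hcard ▸ hc.pow_apply_eq hus
  refine ⟨fun h => ?_, fun h => ?_, (key 3).2 dvd_rfl, fun w hw => ?_⟩
  · have := (key 1).1 h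
    omega
  · have := (key 2).1 h
    omega
  · obtain ⟨n, hn, rfl⟩ := hc.exists_pow_eq hus ((hmem w).2 hw)
    rw [hcard] at hn
    interval_cases n
    · exact .inl rfl
    · exact .inr (.inl rfl)
    · exact .inr (.inr rfl)

/-- `T.Rooted f u v t`: the binary tree `t` lists, in counterclockwise order, the part of `T` that
is seen from `u` through its neighbor `v`; along `t` the depth `f` grows by one at each level. -/
inductive Rooted (T : PlaneBinaryTree V) (f : V → ℕ) : V → V → BinTree V → Prop
  | leaf {u v : V} : T.graph.Adj v u → (T.graph.neighborSet v).ncard = 1 → f v = f u + 1 →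
      Rooted T f u v (.leaf v)
  | node {u v : V} {a b : BinTree V} : T.graph.Adj v u → (T.graph.neighborSet v).ncard = 3 →
      f v = f u + 1 → Rooted T f v (T.rot v u) a → Rooted T f v (T.rot v (T.rot v u)) b →
      Rooted T f u v (.node v a b)

section Rooted

variable {T : PlaneBinaryTree V} {f : V → ℕ} {u v : V} {t a b : BinTree V}

theorem Rooted.root_eq (h : T.Rooted f u v t) : t.root = v := by
  cases h <;> rfl

theorem Rooted.adj (h : T.Rooted f u v t) : T.graph.Adj v u := by
  cases h <;> assumption

theorem Rooted.depth (h : T.Rooted f u v t) : f v = f u + 1 := by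
  cases h <;> assumption

theorem Rooted.mem (h : T.Rooted f u v t) : v ∈ t.support :=
  h.root_eq ▸ t.root_mem_support

theorem Rooted.depth_le (h : T.Rooted f u v t) {x : V} (hx : x ∈ t.support) : f v ≤ f x := by
  induction h with
  | leaf _ _ _ => rw [show x = _ from hx]
  | node _ _ _ ha hb iha ihb =>
    rcases hx with rfl | hx | hx
    · exact le_rfl
    · have := iha hx; have := ha.depth; omega
    · have := ihb hx; have := hb.depth; omega

/-- This is what the depth function is for: it keeps the parent out of the subtree without an
argument about cycles. -/
theorem Rooted.notMem (h : T.Rooted f u v t) : u ∉ t.support := fun hu => by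
  have := h.depth_le hu
  have := h.depth
  omega

/-- The only edge that leaves the support of `t` is the one from its root to its parent. -/
theorem Rooted.boundary (h : T.Rooted f u v t) {x y : V} (hx : x ∈ t.support)
    (hy : y ∉ t.support) (hxy : T.graph.Adj x y) : x = v ∧ y = u := by
  induction h with
  | leaf hu hv _ =>
    obtain rfl : x = _ := hx
    exact ⟨rfl, T.eq_of_adj_of_leaf hv hu hxy⟩
  | node hu hv _ ha hb iha ihb =>
    have hy' := hy
    simp only [BinTree.support, Set.mem_insert_iff, Set.mem_union, not_or] at hy'
    rcases hx with rfl | hx | hx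
    · rcases (T.rot_node hv hu).2.2.2 y hxy with rfl | rfl | rfl
      · exact ⟨rfl, rfl⟩
      · exact absurd ha.mem hy'.2.1
      · exact absurd hb.mem hy'.2.2
    · exact absurd (iha hx hy'.2.1).2 hy'.1
    · exact absurd (ihb hx hy'.2.2).2 hy'.1

/-- Induction from the root downward: a property of the root that passes along the edges inside the
subtree holds on all of it. -/
theorem Rooted.induce_support (h : T.Rooted f u v t) {C : Set V} (hv : v ∈ C)
    (hC : ∀ x ∈ C ∩ t.support, ∀ y ∈ t.support, T.graph.Adj x y → y ∈ C) : t.support ⊆ C := by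
  induction h with
  | leaf _ _ _ => rintro x rfl; exact hv
  | node _ _ _ ha hb iha ihb =>
    rintro x (rfl | hx | hx)
    · exact hv
    · exact iha (hC _ ⟨hv, .inl rfl⟩ _ (.inr (.inl ha.mem)) ha.adj.symm)
        (fun x hx y hy => hC x ⟨hx.1, .inr (.inl hx.2)⟩ y (.inr (.inl hy))) hx
    · exact ihb (hC _ ⟨hv, .inl rfl⟩ _ (.inr (.inr hb.mem)) hb.adj.symm)
        (fun x hx y hy => hC x ⟨hx.1, .inr (.inr hx.2)⟩ y (.inr (.inr hy))) hx

/-- The root `w` is outside `a`, and no edge inside `b` can lead into `a`, because such an edge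
would have to start at `u`, which is not in `b`. -/
theorem Rooted.disjoint (ha : T.Rooted f u v a) {w : V} (hb : T.Rooted f u w b) (hvw : v ≠ w) :
    Disjoint a.support b.support := by
  have hw : w ∉ a.support := fun hw => hvw (ha.boundary hw ha.notMem hb.adj).1.symm
  refine (Set.disjoint_left.2 fun x hxb hxa => ?_ : Disjoint b.support a.support).symm
  refine hb.induce_support (C := a.supportᶜ) hw (fun x hx y hy hxy hya => ?_) hxb hxa
  exact hb.notMem ((ha.boundary hya hx.1 hxy.symm).2 ▸ hx.2)

theorem Rooted.nodup_fringe (h : T.Rooted f u v t) : t.fringe.Nodup := by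
  induction h with
  | leaf _ _ _ => simp [BinTree.fringe]
  | node hu hv _ ha hb iha ihb =>
    refine List.nodup_append.2 ⟨iha, ihb, fun x hx y hy hxy => ?_⟩
    refine Set.disjoint_left.1 (ha.disjoint hb ?_) (BinTree.mem_support_of_mem_fringe hx)
      (hxy ▸ BinTree.mem_support_of_mem_fringe hy)
    exact fun h => (T.rot_node hv (T.adj_rot hu)).1 h.symm

theorem Rooted.fringe_subset (h : T.Rooted f u v t) {x : V} (hx : x ∈ t.fringe) :
    x ∈ T.leaves := by
  induction h with
  | leaf _ hv _ => rw [List.mem_singleton.1 hx]; exact hv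
  | node _ _ _ _ _ iha ihb => exact (List.mem_append.1 hx).elim iha ihb

theorem Rooted.length_fringe_le [Finite V] (h : T.Rooted f u v t) :
    t.fringe.length ≤ T.leaves.ncard := by
  classical
  rw [← List.toFinset_card_of_nodup h.nodup_fringe, ← Set.ncard_coe_finset]
  exact Set.ncard_le_ncard (fun x hx => h.fringe_subset (by simpa using hx)) (Set.toFinite _)

/-- Seen from a leaf, a rooted tree covers everything else. -/
theorem Rooted.mem_support_of_leaf (h : T.Rooted f u v t)
    (hu : (T.graph.neighborSet u).ncard = 1) {x : V} (hx : x ≠ u) : x ∈ t.support := by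
  by_contra hxt
  obtain ⟨p⟩ := T.isTree.connected.preconnected u x
  obtain ⟨d, -, hd, hd'⟩ := p.exists_boundary_dart (insert u t.support) (.inl rfl)
    (by simp [hx, hxt])
  rw [Set.mem_insert_iff, not_or] at hd'
  rcases hd with hd | hd
  · have := T.eq_of_adj_of_leaf hu h.adj.symm (hd ▸ d.adj)
    exact hd'.2 (this ▸ h.mem)
  · exact hd'.1 (h.boundary hd hd'.2 d.adj).2

end Rooted

/-! ### Existence of rooted views, with the distance from the root as depth -/

theorem dist_of_adj_of_ne (T : PlaneBinaryTree V) (r : V) {u v w : V} (hu : T.graph.Adj v u)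
    (hw : T.graph.Adj v w) (h : T.graph.dist r v = T.graph.dist r u + 1) (hwu : w ≠ u) :
    T.graph.dist r w = T.graph.dist r v + 1 := by
  refine (T.isTree.dist_eq_dist_add_one_of_adj r hw).resolve_left fun h' => hwu ?_
  obtain ⟨p, hp⟩ := T.isTree.connected.exists_walk_length_eq_dist r u
  obtain ⟨q, hq⟩ := T.isTree.connected.exists_walk_length_eq_dist r w
  -- If `w` were also closer to `r`, there would be shortest paths to `v` through `u` and through
  -- `w`; uniqueness of paths forces equal penultimate nodes.
  have e1 := (p.concat hu.symm).isPath_of_length_eq_dist (by simp [hp, h])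
  have e2 := (q.concat hw.symm).isPath_of_length_eq_dist (by simp [hq, h'])
  have := congrArg SimpleGraph.Walk.penultimate
    ((T.isTree.existsUnique_path r v).unique e2 e1)
  simpa using this

/-- The number `k` bounds the remaining height: depths stay below the number of nodes, so the
descent ends. -/
theorem exists_rooted_of_dist [Fintype V] (T : PlaneBinaryTree V) (r : V) (k : ℕ) :
    ∀ u v, T.graph.Adj v u → T.graph.dist r v = T.graph.dist r u + 1 →
      Fintype.card V ≤ T.graph.dist r v + k → ∃ t, T.Rooted (T.graph.dist r) u v t := by
  induction k with
  | zero =>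
    intro u v _ _ h
    obtain ⟨p, hp, hl⟩ := T.isTree.connected.exists_path_of_dist r v
    have := hp.length_lt
    omega
  | succ k ih =>
    intro u v hu hd hk
    rcases T.proper v with hv | hv
    · exact ⟨_, .leaf hu hv hd⟩
    · obtain ⟨h1, h2, -, -⟩ := T.rot_node hv hu
      have ha := T.adj_rot hu
      have hb := T.adj_rot ha
      have da := T.dist_of_adj_of_ne r hu ha hd h1
      have db := T.dist_of_adj_of_ne r hu hb hd h2
      obtain ⟨a, hta⟩ := ih v _ ha.symm da (by omega)
      obtain ⟨b, htb⟩ := ih v _ hb.symm db (by omega)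
      exact ⟨_, .node hu hv hd hta htb⟩

/-- From a node of degree three the view through any neighbor ends in leaves. -/
theorem exists_leaf [Finite V] (T : PlaneBinaryTree V) :
    ∃ r, (T.graph.neighborSet r).ncard = 1 := by
  have := Fintype.ofFinite V
  obtain ⟨r⟩ := T.isTree.connected.nonempty
  rcases T.proper r with h | h
  · exact ⟨r, h⟩
  · have hne : (T.graph.neighborSet r).Nonempty := Set.nonempty_of_ncard_ne_zero (by omega)
    obtain ⟨w, hw⟩ := hne
    obtain ⟨t, ht⟩ := T.exists_rooted_of_dist r (Fintype.card V) r w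
      (SimpleGraph.Adj.symm hw) (by simpa using SimpleGraph.dist_eq_one_iff_adj.2 hw) (by omega)
    have h3 := t.length_tour_add_three_le
    obtain ⟨x, hx⟩ := List.exists_mem_of_length_pos (l := t.fringe) (by omega)
    exact ⟨x, ht.fringe_subset hx⟩

theorem exists_rooted [Finite V] (T : PlaneBinaryTree V) {r w : V} (h : T.graph.Adj r w) :
    ∃ t, T.Rooted (T.graph.dist r) r w t := by
  have := Fintype.ofFinite V
  exact T.exists_rooted_of_dist r (Fintype.card V) r w h.symm
    (by simpa using SimpleGraph.dist_eq_one_iff_adj.2 h) (by omega)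

/-! ### The walk around the tree -/

/-- Started at `d`, the walk around `T` meets the nodes in the list, one in each step, and
then is at `d'`. -/
inductive Trace (T : PlaneBinaryTree V) : V × V → List V → V × V → Prop
  | nil (d : V × V) : Trace T d [] d
  | cons {d d' : V × V} {L : List V} : Trace T (T.contourStep d) L d' →
      Trace T d (d.2 :: L) d'

theorem Trace.append {T : PlaneBinaryTree V} {d d' d'' : V × V} {L L' : List V}
    (h : T.Trace d L d') (h' : T.Trace d' L' d'') : T.Trace d (L ++ L') d'' := by
  induction h with
  | nil _ => exact h'
  | cons _ ih => exact .cons (ih h')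

theorem Trace.split {T : PlaneBinaryTree V} {d d'' : V × V} {L L' : List V}
    (h : T.Trace d (L ++ L') d'') : ∃ d', T.Trace d L d' ∧ T.Trace d' L' d'' := by
  induction L generalizing d with
  | nil => exact ⟨d, .nil d, h⟩
  | cons x L ih =>
    cases h with
    | cons h =>
      obtain ⟨d', h1, h2⟩ := ih h
      exact ⟨d', .cons h1, h2⟩

theorem Trace.iterate {T : PlaneBinaryTree V} {d d' : V × V} {L : List V} {b : V} {M : Finset V}
    (h : T.Trace d (L ++ [b]) d') (hL : ∀ x ∈ L, x ∉ M) : ∃ k : ℕ, 0 < k ∧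
      (T.contourStep^[k] d).1 = b ∧ ∀ j : ℕ, 0 < j → j < k → (T.contourStep^[j] d).1 ∉ M := by
  induction L generalizing d with
  | nil =>
    cases h with
    | cons h => exact ⟨1, one_pos, rfl, fun j _ _ => by omega⟩
  | cons x L ih =>
    cases h with
    | cons h =>
      obtain ⟨k, hk, hb, hj⟩ := ih h fun y hy => hL y (.tail _ hy)
      refine ⟨k + 1, by omega, hb, fun j hj0 hjk => ?_⟩
      obtain ⟨j, rfl⟩ : ∃ i, j = i + 1 := ⟨j - 1, by omega⟩
      rcases Nat.eq_zero_or_pos j with rfl | hj0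
      · exact hL _ (.head _)
      · exact hj j hj0 (by omega)

theorem Trace.adj {T : PlaneBinaryTree V} {d d' : V × V} {L : List V} (h : T.Trace d L d')
    (hd : T.graph.Adj d.1 d.2) : T.graph.Adj d'.1 d'.2 := by
  induction h with
  | nil _ => exact hd
  | cons _ ih => exact ih (T.adj_rot hd.symm)

theorem Trace.fst_of_append_singleton {T : PlaneBinaryTree V} {d d' : V × V} {L : List V} {x : V}
    (h : T.Trace d (L ++ [x]) d') : d'.1 = x := by
  obtain ⟨e, -, h⟩ := h.split
  cases h with
  | cons h => cases h; rfl

theorem Trace.follows {T : PlaneBinaryTree V} {M : Finset V} {d d' : V × V} {K L L' : List V}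
    {x y : V} (h : T.Trace d (K ++ x :: (L ++ y :: L')) d') (hd : T.graph.Adj d.1 d.2)
    (hx : x ∈ M) (hy : y ∈ M) (hL : ∀ z ∈ L, z ∉ M) : T.Follows M x y := by
  have e : K ++ x :: (L ++ y :: L') = (K ++ [x]) ++ ((L ++ [y]) ++ L') := by simp
  rw [e] at h
  obtain ⟨⟨x', w⟩, h1, h2⟩ := h.split
  obtain ⟨_, h2, -⟩ := h2.split
  obtain rfl : x' = x := h1.fst_of_append_singleton
  exact ⟨hx, hy, w, h1.adj hd, h2.iterate hL⟩

/-- The walk enters a subtree by its root edge, makes the tour, and leaves by the same edge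
reversed; at an inner node the third rotation points back to the parent. -/
theorem Rooted.trace {T : PlaneBinaryTree V} {f : V → ℕ} {u v : V} {t : BinTree V}
    (h : T.Rooted f u v t) : T.Trace (u, v) t.tour (v, u) := by
  induction h with
  | @leaf u v hu hv _ =>
    refine .cons ?_
    rw [contourStep, T.rot_leaf hv hu]
    exact .nil _
  | @node u v a b hu hv _ ha hb iha ihb =>
    refine .cons (iha.append (.cons (ihb.append (.cons ?_))))
    have : T.contourStep (T.rot v (T.rot v u), v) = (v, u) := by
      rw [contourStep, (T.rot_node hv hu).2.2.1]
    rw [this]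
    exact .nil _

theorem exists_append_of_getLast?_filter {α : Type*} {p : α → Bool} {l : List α} {x : α}
    (h : (l.filter p).getLast? = some x) :
    ∃ K L, l = K ++ x :: L ∧ p x ∧ ∀ z ∈ L, ¬ p z := by
  induction l using List.reverseRecOn with
  | nil => simp at h
  | append_singleton l y ih =>
    by_cases hy : p y
    · simp only [List.filter_append, List.filter_singleton, hy, cond_true,
        List.getLast?_append, List.getLast?_singleton, Option.some_or, Option.some.injEq] at h
      subst h
      exact ⟨l, [], rfl, hy, by simp⟩
    · simp only [List.filter_append, List.filter_singleton, hy, cond_false,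
        List.append_nil] at h
      obtain ⟨K, L, rfl, hx, hL⟩ := ih h
      refine ⟨K, L ++ [y], by simp, hx, fun z hz => ?_⟩
      rcases List.mem_append.1 hz with hz | hz
      · exact hL z hz
      · rwa [List.mem_singleton.1 hz]

theorem exists_append_of_head?_filter {α : Type*} {p : α → Bool} {l : List α} {x : α}
    (h : (l.filter p).head? = some x) :
    ∃ K L, l = K ++ x :: L ∧ p x ∧ ∀ z ∈ K, ¬ p z := by
  obtain ⟨L, hL⟩ := List.head?_eq_some_iff.1 h
  obtain ⟨K, L', h1, h2, h3, -⟩ := List.filter_eq_cons_iff.1 hL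
  exact ⟨K, L', h1, h3, h2⟩

open Classical in
/-- The marked labels of a tree, from left to right. -/
noncomputable def _root_.BinTree.among (M : Finset V) (t : BinTree V) : List V :=
  t.tour.filter (· ∈ M)

/-- Between the two leaves the walk meets only the unmarked rest of `a`, the node `v`, and the
unmarked beginning of `b`. -/
theorem follows_of_node {T : PlaneBinaryTree V} {f : V → ℕ} {u v x y : V} {a b : BinTree V}
    {M : Finset V} (h : T.Rooted f u v (.node v a b)) (hv : v ∉ M)
    (hx : (a.among M).getLast? = some x) (hy : (b.among M).head? = some y) :
    T.Follows M x y := by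
  obtain ⟨K, L, ha, hxM, hL⟩ := exists_append_of_getLast?_filter hx
  obtain ⟨K', L', hb, hyM, hK'⟩ := exists_append_of_head?_filter hy
  have ht := h.trace
  have e : (BinTree.node v a b).tour = (v :: K) ++ x :: ((L ++ v :: K') ++ y :: (L' ++ [v])) := by
    simp [BinTree.tour, ha, hb]
  rw [e] at ht
  refine ht.follows h.adj.symm (by simpa using hxM) (by simpa using hyM) fun z hz => ?_
  rcases List.mem_append.1 hz with hz | hz
  · simpa using hL z hz
  · rcases List.mem_cons.1 hz with rfl | hz
    · exact hv
    · simpa using hK' z hz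

end PlaneBinaryTree

/-! ### The selection -/

/-- The state of a rooted subtree: it contains no marked leaf, or exactly one, or its marked leaves
have been dealt with, except for those that are pending on the left-hand side and on the
right-hand side, listed from the top of the subtree to its bottom. -/
inductive Status (V : Type*) where
  | empty
  | one (l : V)
  | many (p q : List V)

namespace BinTree

variable {V : Type*}

theorem mem_of_mem_among {M : Finset V} {t : BinTree V} {x : V} (h : x ∈ t.among M) :
    x ∈ M ∧ x ∈ t.support := by
  simpa [among, mem_tour, and_comm] using h

theorem among_node {M : Finset V} {v : V} {a b : BinTree V} (hv : v ∉ M) :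
    (node v a b).among M = a.among M ++ b.among M := by
  simp [among, tour, hv]

theorem among_leaf {M : Finset V} {v : V} (hv : v ∈ M) : (leaf v).among M = [v] := by
  simp [among, tour, hv]

theorem among_leaf_of_notMem {M : Finset V} {v : V} (hv : v ∉ M) : (leaf v).among M = [] := by
  simp [among, tour, hv]

end BinTree

namespace MarkedTree

variable {V : Type*}

open Classical in
/-- A leaf `l` that hangs off the node `v` meets the leaves `p` pending on the same side: either a
leaf is selected, or `l` becomes pending. -/
noncomputable def push (T : MarkedTree V) (v l : V) (p : List V) : V ⊕ List V :=
  if v ∈ T.nh l then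
    match p with
    | x :: _ :: _ => .inl x
    | _ => .inr (l :: p)
  else .inl l

open Classical in
/-- The state of the subtree rooted at `v`, from the states of its left and its right part, and the
leaf that is selected at `v`, if any. -/
noncomputable def combine (T : MarkedTree V) (v : V) : Status V → Status V → Status V × Option V
  | .empty, s => (s, none)
  | .one l, .empty => (.one l, none)
  | .many p q, .empty => (.many p q, none)
  | .one l, .one l' => (.many [] [], some (if v ∈ T.nh l then l' else l))
  | .one l, .many p q =>
    match T.push v l p with
    | .inl x => (.many [] [], some x)
    | .inr p' => (.many p' q, none)
  | .many p q, .one l =>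
    match T.push v l q with
    | .inl x => (.many [] [], some x)
    | .inr q' => (.many p q', none)
  | .many _ _, .many _ _ => (.many [] [], none)

open Classical in
noncomputable def status (T : MarkedTree V) : BinTree V → Status V
  | .leaf v => if v ∈ T.marked then .one v else .empty
  | .node v a b => (T.combine v (T.status a) (T.status b)).1

open Classical in
/-- The leaves selected in a rooted subtree. -/
noncomputable def selected (T : MarkedTree V) : BinTree V → Finset V
  | .leaf _ => ∅
  | .node v a b =>
    T.selected a ∪ T.selected b ∪ (T.combine v (T.status a) (T.status b)).2.toFinset

/-- The neighborhoods of `a` and `b` are disjoint and not joined by an edge. -/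
def Apart (T : MarkedTree V) (a b : V) : Prop :=
  Disjoint (T.nh a) (T.nh b) ∧ ∀ x ∈ T.nh a, ∀ y ∈ T.nh b, ¬ T.graph.Adj x y

/-- `A` is a set of marked leaves that are pairwise apart and whose neighborhoods are contained in
`D` and avoid `v`. -/
structure Confined (T : MarkedTree V) (D : Set V) (v : V) (A : Finset V) : Prop where
  marked : ∀ x ∈ A, x ∈ T.marked
  subset : ∀ x ∈ A, T.nh x ⊆ D \ {v}
  apart : ∀ x ∈ A, ∀ y ∈ A, x ≠ y → T.Apart x y

/-- What is known of the leaves pending on one side of a subtree with nodes `D`, in which `A` has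
been selected. -/
def Pending (T : MarkedTree V) (D : Set V) (A : Finset V) : List V → Prop
  | [] => True
  | [l] => l ∈ T.marked ∧ l ∈ D ∧ ∃ (c : V) (E : Set V), c ∈ T.nh l ∧ E ⊆ D ∧
      (∀ x ∈ E, ∀ y ∉ E, T.graph.Adj x y → x = c) ∧ ∀ x ∈ A, T.nh x ⊆ E \ {c}
  | [l, _] => l ∈ T.marked ∧ l ∈ D ∧ l ∉ A ∧ ∀ x ∈ A, T.Apart x l
  | _ => False

/-! ### Confinement of neighborhoods and the rules for pending leaves -/

variable {T : MarkedTree V}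

theorem Apart.symm {a b : V} (h : T.Apart a b) : T.Apart b a :=
  ⟨h.1.symm, fun x hx y hy hxy => h.2 y hy x hx hxy.symm⟩

/-- A path inside the connected set `nh l` from `l` to a node outside `S` would have to cross the
boundary of `S`. -/
theorem nh_subset {l : V} {S : Set V} (hl : l ∈ T.marked) (hlS : l ∈ S)
    (hS : ∀ x ∈ T.nh l, x ∈ S → ∀ y ∈ T.nh l, y ∉ S → ¬ T.graph.Adj x y) : T.nh l ⊆ S := by
  intro x hx
  by_contra hxS
  obtain ⟨p⟩ := (T.nh_connected l hl).preconnected ⟨l, T.mem_nh l hl⟩ ⟨x, hx⟩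
  obtain ⟨d, -, hd, hd'⟩ := p.exists_boundary_dart (Subtype.val ⁻¹' S) hlS hxS
  exact hS _ d.fst.2 hd _ d.snd.2 hd' d.adj

theorem Confined.empty (T : MarkedTree V) (D : Set V) (v : V) : T.Confined D v ∅ :=
  ⟨by simp, by simp, by simp⟩

theorem Confined.mono {D D' : Set V} {v v' : V} {A : Finset V} (h : T.Confined D v A)
    (hD : D ⊆ D') (hv' : v' ∉ D) : T.Confined D' v' A :=
  ⟨h.marked, fun x hx _ hy => ⟨hD (h.subset x hx hy).1, fun e => hv' (e ▸ (h.subset x hx hy).1)⟩,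
    h.apart⟩

open Classical in
theorem Confined.insert {D : Set V} {v x : V} {A : Finset V} (h : T.Confined D v A)
    (hx : x ∈ T.marked) (hxD : T.nh x ⊆ D \ {v}) (hA : ∀ y ∈ A, T.Apart y x) :
    T.Confined D v (Insert.insert x A) := by
  refine ⟨fun y hy => ?_, fun y hy => ?_, fun y hy z hz hyz => ?_⟩
  · rcases Finset.mem_insert.1 hy with rfl | hy
    exacts [hx, h.marked y hy]
  · rcases Finset.mem_insert.1 hy with rfl | hy
    exacts [hxD, h.subset y hy]
  · rcases Finset.mem_insert.1 hy with rfl | hy' <;> rcases Finset.mem_insert.1 hz with rfl | hz'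
    exacts [absurd rfl hyz, (hA z hz').symm, hA y hy', h.apart y hy' z hz' hyz]

theorem Confined.mem {D : Set V} {v x : V} {A : Finset V} (h : T.Confined D v A) (hx : x ∈ A) :
    x ∈ D :=
  (h.subset x hx (T.mem_nh x (h.marked x hx))).1

theorem Pending.mono {D D' : Set V} {A : Finset V} {p : List V} (h : T.Pending D A p)
    (hD : D ⊆ D') : T.Pending D' A p := by
  match p, h with
  | [], _ => trivial
  | [_], ⟨h1, h2, c, E, h3, h4, h5⟩ => exact ⟨h1, hD h2, c, E, h3, h4.trans hD, h5⟩
  | [_, _], ⟨h1, h2, h3⟩ => exact ⟨h1, hD h2, h3⟩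

theorem Pending.length_le {D : Set V} {A : Finset V} {p : List V} (h : T.Pending D A p) :
    p.length ≤ 2 := by
  match p, h with
  | [], _ => simp
  | [_], _ => simp
  | [_, _], _ => simp

section

variable {f : V → ℕ} {u v : V} {t a b : BinTree V}

theorem nh_subset_support {v' l : V} (ha : T.Rooted f v v' a) (hl : l ∈ T.marked)
    (hla : l ∈ a.support) (hv : v ∉ T.nh l) : T.nh l ⊆ a.support :=
  nh_subset hl hla fun _ _ hx _ hy hya hxy => hv ((ha.boundary hx hya hxy).2 ▸ hy)

/-- An edge leaving `a` can only end at the common parent `v`, which does not lie in `b`. -/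
theorem apart_of_disjoint {va vb : V} (ha : T.Rooted f v va a) (hb : T.Rooted f v vb b)
    (hab : Disjoint a.support b.support) {x y : V} (hx : T.nh x ⊆ a.support)
    (hy : T.nh y ⊆ b.support) : T.Apart x y :=
  ⟨hab.mono hx hy, fun _ hi _ hj hij => hb.notMem
    ((ha.boundary (hx hi) (fun h => Set.disjoint_left.1 hab h (hy hj)) hij).2 ▸ hy hj)⟩

open Classical in
/-- The effect of `push`: the leaf `l` of `a` hangs off `v`, whose other subtree is `b`. -/
theorem push_spec {va vb l : V} {D : Set V} {A : Finset V} {p : List V}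
    (ha : T.Rooted f v va a) (hb : T.Rooted f v vb b) (hab : Disjoint a.support b.support)
    (haD : a.support ⊆ D) (hbD : b.support ⊆ D) (hvD : v ∈ D) (hl : l ∈ T.marked) (hla : l ∈ a.support)
    (hA : T.Confined b.support vb A) (hp : T.Pending b.support A p)
    (hD : ∀ x ∈ p.head?, Disjoint (T.nh x) (T.nh l)) :
    (∃ x, T.push v l p = .inl x ∧ x ∉ A ∧ T.Confined D v (insert x A)) ∨
      T.push v l p = .inr (l :: p) ∧ T.Pending D A (l :: p) := by
  have hA' := hA.mono hbD hb.notMem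
  have hlA : l ∉ A := fun h => Set.disjoint_left.1 hab hla (hA.mem h)
  have hAb : ∀ x ∈ A, T.nh x ⊆ b.support := fun x hx y hy => (hA.subset x hx hy).1
  by_cases hv : v ∈ T.nh l
  · match p, hp with
    | [], _ =>
      -- First pending leaf: the separating node is `v` itself, since `b` together with `v` can be
      -- left only through `v`.
      refine .inr ⟨by simp [push, hv], hl, haD hla, v, Insert.insert v b.support, hv,
        Set.insert_subset hvD hbD, fun x hx y hy hxy => ?_, fun x hx y hy =>
        ⟨.inr (hAb x hx hy), fun e => hb.notMem (e ▸ hAb x hx hy)⟩⟩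
      rw [Set.mem_insert_iff, not_or] at hy
      exact hx.resolve_right fun hx => hy.1 (hb.boundary hx hy.2 hxy).2
    | [x], ⟨hx, hxb, c, E, hc, hE, hEc, hAE⟩ =>
      refine .inr ⟨by simp [push, hv], hl, haD hla, hlA, fun y hy => ?_⟩
      -- The region `E` can be entered only at `c`, which belongs to the disjoint neighborhood of
      -- `x`.
      have hlE : T.nh l ⊆ Eᶜ := nh_subset hl (fun h => Set.disjoint_left.1 hab hla (hE h))
        fun i hi hiE j hj hjE hij => by
          rw [hEc j (not_not.1 hjE) i hiE hij.symm] at hj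
          exact Set.disjoint_left.1 (hD x rfl) hc hj
      refine ⟨Set.disjoint_left.2 fun i hi hi' => hlE hi' (hAE y hy hi).1, fun i hi j hj hij => ?_⟩
      exact (hAE y hy hi).2 (hEc i (hAE y hy hi).1 j (hlE hj) hij)
    | [x, _], ⟨hx, hxb, hxA, hAx⟩ =>
      -- Third leaf: `v` is taken by `nh l`, so `nh x` cannot leave `b`, and `x` is already known to
      -- be apart from `A`.
      refine .inl ⟨x, by simp [push, hv], hxA, hA'.insert hx ?_ hAx⟩
      have hvx : v ∉ T.nh x := fun h => Set.disjoint_left.1 (hD x rfl) h hv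
      exact fun y hy => ⟨hbD (nh_subset_support hb hx hxb hvx hy), fun e => hvx (e ▸ hy)⟩
  · have hla' := nh_subset_support ha hl hla hv
    exact .inl ⟨l, by simp [push, hv], hlA, hA'.insert hl
      (fun y hy => ⟨haD (hla' hy), fun e => hv (e ▸ hy)⟩) fun y hy =>
      apart_of_disjoint hb ha hab.symm (hAb y hy) hla'⟩

theorem notMem_marked_of_node (hv : (T.graph.neighborSet v).ncard = 3) : v ∉ T.marked := fun h => by
  have : (T.graph.neighborSet v).ncard = 1 := T.marked_leaf v h
  omega

/-- The last marked leaf of the left part and the first one of the right part have disjoint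
neighborhoods. -/
theorem disjoint_nh_of_node {x y : V} (h : T.Rooted f u v (.node v a b))
    (hx : (a.among T.marked).getLast? = some x) (hy : (b.among T.marked).head? = some y) :
    Disjoint (T.nh x) (T.nh y) := by
  cases h with
  | node hu hv _ ha hb =>
    refine T.nh_disjoint x y (PlaneBinaryTree.follows_of_node (.node hu hv ‹_› ha hb)
      (notMem_marked_of_node hv) hx hy) fun e => ?_
    have hab := ha.disjoint hb fun e => (T.rot_node hv (T.adj_rot hu)).1 e.symm
    exact Set.disjoint_left.1 hab (BinTree.mem_of_mem_among (List.mem_of_getLast? hx)).2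
      (e ▸ (BinTree.mem_of_mem_among (List.mem_of_head? hy)).2)

/-- What is known of a rooted subtree with nodes `D` and marked leaves `M`, when `A` has been
selected in it. -/
def StatusSpec (T : MarkedTree V) (D : Set V) (M : List V) (A : Finset V) : Status V → Prop
  | .empty => M = [] ∧ A = ∅
  | .one l => M = [l] ∧ A = ∅
  | .many p q => T.Pending D A p ∧ T.Pending D A q ∧ (∀ x ∈ p.head?, M.head? = some x) ∧
      (∀ x ∈ q.head?, M.getLast? = some x) ∧ M.length + 8 ≤ 10 * A.card + p.length + q.length

theorem StatusSpec.mono {D D' : Set V} {M : List V} {A : Finset V} {s : Status V}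
    (h : T.StatusSpec D M A s) (hD : D ⊆ D') : T.StatusSpec D' M A s := by
  match s, h with
  | .empty, h => exact h
  | .one _, h => exact h
  | .many _ _, h => exact ⟨h.1.mono hD, h.2.1.mono hD, h.2.2⟩

-- Induction over the subtree. That the topmost pending leaf on each side is the extreme marked leaf
-- of the subtree is what makes it consecutive to the next leaf arriving there.
open Classical in
theorem status_spec (h : T.Rooted f u v t) :
    T.Confined t.support v (T.selected t) ∧
      T.StatusSpec t.support (t.among T.marked) (T.selected t) (T.status t) := by
  induction h with
  | @leaf u v hu hv _ =>
    refine ⟨Confined.empty _ _ _, ?_⟩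
    by_cases hm : v ∈ T.marked
    · simp [status, hm, selected, StatusSpec, BinTree.among_leaf]
    · simp [status, hm, selected, StatusSpec, BinTree.among_leaf_of_notMem]
  | @node u v a b hu hv hd ha hb iha ihb =>
    have hfol := fun x y => disjoint_nh_of_node (x := x) (y := y) (.node hu hv hd ha hb)
    have hab := ha.disjoint hb fun e => (T.rot_node hv (T.adj_rot hu)).1 e.symm
    have haD : a.support ⊆ (BinTree.node v a b).support := fun x hx => .inr (.inl hx)
    have hbD : b.support ⊆ (BinTree.node v a b).support := fun x hx => .inr (.inr hx)
    have hvD : v ∈ (BinTree.node v a b).support := .inl rfl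
    obtain ⟨hca, hsa⟩ := iha
    obtain ⟨hcb, hsb⟩ := ihb
    have hca' := hca.mono haD ha.notMem
    have hcb' := hcb.mono hbD hb.notMem
    have hMa : ∀ x ∈ a.among T.marked, x ∈ T.marked ∧ x ∈ a.support :=
      fun x hx => BinTree.mem_of_mem_among hx
    have hMb : ∀ x ∈ b.among T.marked, x ∈ T.marked ∧ x ∈ b.support :=
      fun x hx => BinTree.mem_of_mem_among hx
    rw [BinTree.among_node (notMem_marked_of_node hv), status, selected]
    generalize a.among T.marked = M at *
    generalize b.among T.marked = M' at *
    generalize T.selected a = A at *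
    generalize T.selected b = A' at *
    generalize T.status a = s at *
    generalize T.status b = s' at *
    generalize (BinTree.node v a b).support = D at *
    match s, s', hsa, hsb with
    | .empty, s', ⟨hM, hA⟩, hsb =>
      subst hM hA
      simp only [combine, List.nil_append, Option.toFinset_none, Finset.empty_union,
        Finset.union_empty]
      exact ⟨hcb', hsb.mono hbD⟩
    | .one l, .empty, ⟨hM, hA⟩, ⟨hM', hA'⟩ =>
      subst hM hA hM' hA'
      simp [combine, StatusSpec, Confined.empty]
    | .many p q, .empty, hsa, ⟨hM', hA'⟩ =>
      subst hM' hA'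
      simp only [combine, List.append_nil, Option.toFinset_none, 
        Finset.union_empty]
      exact ⟨hca', hsa.1.mono haD, hsa.2.1.mono haD, hsa.2.2⟩
    | .one l, .one l', ⟨hM, hA⟩, ⟨hM', hA'⟩ =>
      subst hM hA hM' hA'
      obtain ⟨hl, hla⟩ := hMa l (by simp)
      obtain ⟨hl', hlb⟩ := hMb l' (by simp)
      have hsel : ∀ x, x ∈ T.marked → T.nh x ⊆ D → v ∉ T.nh x → T.Confined D v {x} :=
        fun x hx hxD hvx => (Confined.empty T D v).insert hx
          (fun y hy => ⟨hxD hy, fun e => hvx (e ▸ hy)⟩) (by simp)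
      simp only [combine, Option.toFinset_some, Finset.empty_union]
      -- Two marked leaves and one selected: `2 + 8 = 10`, with equality.
      refine ⟨?_, by simp [StatusSpec, Pending]⟩
      split_ifs with hvl
      · have hvl' : v ∉ T.nh l' := Set.disjoint_left.1 (hfol l l' (by simp) (by simp)) hvl
        exact hsel l' hl' ((nh_subset_support hb hl' hlb hvl').trans hbD) hvl'
      · exact hsel l hl ((nh_subset_support ha hl hla hvl).trans haD) hvl
    | .one l, .many p q, ⟨hM, hA⟩, ⟨h1, h2, h3, h4, h5⟩ =>
      subst hM hA
      have := h1.length_le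
      have := h2.length_le
      rcases push_spec (p := p) ha hb hab haD hbD hvD (hMa l (by simp)).1 (hMa l (by simp)).2 hcb h1
        (fun x hx => (hfol _ _ (by simp) (h3 x hx)).symm) with ⟨x, h6, h7, h8⟩ | ⟨h6, h7⟩
      · simp only [combine, h6, Option.toFinset_some, Finset.empty_union, Finset.union_singleton]
        refine ⟨h8, trivial, trivial, by simp, by simp, ?_⟩
        -- One new marked leaf and at most four dropped pending leaves, against a gain of ten.
        simp only [List.length_append, List.length_singleton, Finset.card_insert_of_notMem h7,
          List.length_nil]
        omega
      · simp only [combine, h6, Option.toFinset_none, Finset.empty_union, Finset.union_empty]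
        refine ⟨hcb', h7, h2.mono hbD, by simp, fun x hx => ?_, ?_⟩
        · rw [List.getLast?_append, h4 x hx, Option.some_or]
        · simp only [List.length_append, List.length_cons, List.length_nil]
          omega
    | .many p q, .one l, ⟨h1, h2, h3, h4, h5⟩, ⟨hM, hA⟩ =>
      subst hM hA
      have := h1.length_le
      have := h2.length_le
      rcases push_spec (p := q) hb ha hab.symm hbD haD hvD (hMb l (by simp)).1 (hMb l (by simp)).2
        hca h2 (fun x hx => hfol _ _ (h4 x hx) (by simp)) with ⟨x, h6, h7, h8⟩ | ⟨h6, h7⟩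
      · simp only [combine, h6, Option.toFinset_some, Finset.union_empty, Finset.union_singleton]
        refine ⟨h8, trivial, trivial, by simp, by simp, ?_⟩
        simp only [List.length_append, List.length_singleton, Finset.card_insert_of_notMem h7,
          List.length_nil]
        omega
      · simp only [combine, h6, Option.toFinset_none, Finset.union_empty]
        refine ⟨hca', h1.mono haD, h7, fun x hx => ?_, by simp, ?_⟩
        · rw [List.head?_append, h3 x hx, Option.some_or]
        · simp only [List.length_append, List.length_cons, List.length_nil]
          omega
    | .many p q, .many p' q', ⟨h1, h2, h3, h4, h5⟩, ⟨h1', h2', h3', h4', h5'⟩ =>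
      have := h1.length_le
      have := h2.length_le
      have := h1'.length_le
      have := h2'.length_le
      have hAA' : Disjoint A A' := Finset.disjoint_left.2 fun x hx hx' =>
        Set.disjoint_left.1 hab (hca.mem hx) (hcb.mem hx')
      have hap : ∀ x ∈ A, ∀ y ∈ A', T.Apart x y := fun x hx y hy =>
        apart_of_disjoint ha hb hab (fun i hi => (hca.subset x hx hi).1)
          (fun i hi => (hcb.subset y hy hi).1)
      simp only [combine, Option.toFinset_none, Finset.union_empty]
      refine ⟨⟨fun x hx => ?_, fun x hx => ?_, fun x hx y hy hxy => ?_⟩, trivial, trivial, by simp,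
        by simp, ?_⟩
      · exact (Finset.mem_union.1 hx).elim (hca.marked x) (hcb.marked x)
      · exact (Finset.mem_union.1 hx).elim (hca'.subset x) (hcb'.subset x)
      · rcases Finset.mem_union.1 hx with hx | hx <;> rcases Finset.mem_union.1 hy with hy | hy
        exacts [hca.apart x hx y hy hxy, hap x hx y hy, (hap y hy x hx).symm,
          hcb.apart x hx y hy hxy]
      -- Adding the two invariants gives `16` on the left and at most `8` pending leaves on the
      -- right, which leaves exactly the required `8`.
      · simp only [List.length_append, List.length_nil, Finset.card_union_of_disjoint hAA']
        omega

open Classical in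
/-- The selection obtained when the tree is rooted at the leaf `r`. -/
noncomputable def selection (T : MarkedTree V) (r : V) (t : BinTree V) : Finset V :=
  match T.status t with
  | .empty => if r ∈ T.marked then {r} else ∅
  | .one l => {l}
  | .many _ _ => T.selected t

theorem isSelection_singleton {x : V} (hx : x ∈ T.marked) : T.IsSelection {x} :=
  ⟨by simpa using hx, fun a ha b hb hab =>
    absurd ((Finset.mem_singleton.1 ha).trans (Finset.mem_singleton.1 hb).symm) hab⟩

-- Only the root leaf lies outside `t`, so at most one marked leaf is missed.
open Classical in
theorem card_marked_le {r : V} (h : T.Rooted f r v t) (hr : (T.graph.neighborSet r).ncard = 1) :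
    T.marked.card ≤ (t.among T.marked).length + if r ∈ T.marked then 1 else 0 := by
  have h1 : T.marked ⊆ (t.among T.marked).toFinset ∪ if r ∈ T.marked then {r} else ∅ := by
    intro x hx
    by_cases hxr : x = r
    · subst hxr
      simp [hx]
    · have := h.mem_support_of_leaf hr hxr
      simp [BinTree.among, BinTree.mem_tour, this, hx]
  refine (Finset.card_le_card h1).trans ((Finset.card_union_le _ _).trans ?_)
  refine add_le_add (List.toFinset_card_le _) ?_
  split_ifs <;> simp

open Classical in
theorem selection_spec {r : V} (h : T.Rooted f r v t) (hr : (T.graph.neighborSet r).ncard = 1) :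
    T.IsSelection (T.selection r t) ∧ T.marked.card ≤ 10 * (T.selection r t).card := by
  obtain ⟨hc, hs⟩ := status_spec h
  have hcard := card_marked_le h hr
  have hmem : ∀ x ∈ t.among T.marked, x ∈ T.marked := fun x hx => (BinTree.mem_of_mem_among hx).1
  rw [selection]
  generalize T.status t = s at *
  match s, hs with
  | .empty, ⟨hM, _⟩ =>
    rw [hM] at hcard
    dsimp only
    split_ifs at hcard ⊢ with hm
    · exact ⟨isSelection_singleton hm, by simp at hcard ⊢; omega⟩
    · exact ⟨⟨by simp, by simp⟩, by simpa using hcard⟩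
  | .one l, ⟨hM, _⟩ =>
    refine ⟨isSelection_singleton (hmem l (by simp [hM])), ?_⟩
    rw [hM] at hcard
    simp only [List.length_singleton, Finset.card_singleton] at hcard ⊢
    split_ifs at hcard <;> omega
  | .many p q, ⟨h1, h2, _, _, h5⟩ =>
    have := h1.length_le
    have := h2.length_le
    refine ⟨⟨hc.marked, hc.apart⟩, ?_⟩
    dsimp only
    split_ifs at hcard <;> omega

theorem exists_selection [Finite V] (T : MarkedTree V) :
    ∃ S : Finset V, T.IsSelection S ∧ (T.marked.card : ℝ) / 10 ≤ (S.card : ℝ) := by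
  obtain ⟨r, hr⟩ := T.exists_leaf
  obtain ⟨w, hw⟩ := Set.nonempty_of_ncard_ne_zero (s := T.graph.neighborSet r) (by omega)
  obtain ⟨t, ht⟩ := T.exists_rooted hw
  obtain ⟨h1, h2⟩ := selection_spec ht hr
  refine ⟨_, h1, ?_⟩
  have : (T.marked.card : ℝ) ≤ 10 * (T.selection r t).card := by exact_mod_cast h2
  linarith

end

end MarkedTree

/-! ### Programs without loops -/

namespace RAM

open Classical in
/-- The effect of a program without loops. -/
noncomputable def Prog.run : Prog → State → State
  | .skip, s => s
  | .assign x e, s => s.setReg x (e.eval s)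
  | .write a i e, s => s.setArr a (i.eval s) (e.eval s)
  | .assignReal x e, s => s.setReal x (e.eval s)
  | .seq c d, s => d.run (c.run s)
  | .ite t c d, s => if t.holds s then c.run s else d.run s
  | .loop _ _, s => s

def Prog.LoopFree : Prog → Prop
  | .seq c d => c.LoopFree ∧ d.LoopFree
  | .ite _ c d => c.LoopFree ∧ d.LoopFree
  | .loop _ _ => False
  | _ => True

/-- A bound on the number of steps of a program without loops. -/
def Prog.bound : Prog → ℕ
  | .skip => 1
  | .assign _ e => e.cost + 1
  | .write _ i e => i.cost + e.cost + 1
  | .assignReal _ e => e.cost + 1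
  | .seq c d => c.bound + d.bound
  | .ite t c d => t.cost + (c.bound + d.bound)
  | .loop _ _ => 0

theorem Prog.LoopFree.exec_run {c : Prog} (h : c.LoopFree) (s : State) :
    ∃ k ≤ c.bound, Exec c s k (c.run s) := by
  induction c generalizing s with
  | skip => exact ⟨_, le_rfl, .skip s⟩
  | assign x e => exact ⟨_, le_rfl, .assign s x e⟩
  | write a i e => exact ⟨_, le_rfl, .write s a i e⟩
  | assignReal x e => exact ⟨_, le_rfl, .assignReal s x e⟩
  | seq c d ihc ihd =>
    obtain ⟨k, hk, h1⟩ := ihc h.1 s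
    obtain ⟨k', hk', h2⟩ := ihd h.2 (c.run s)
    exact ⟨_, add_le_add hk hk', .seq h1 h2⟩
  | ite t c d ihc ihd =>
    by_cases ht : t.holds s
    · obtain ⟨k, hk, h1⟩ := ihc h.1 s
      refine ⟨t.cost + k, ?_, ?_⟩
      · simp only [bound]; omega
      · simpa [run, ht] using Exec.iteTrue ht h1
    · obtain ⟨k, hk, h1⟩ := ihd h.2 s
      refine ⟨t.cost + k, ?_, ?_⟩
      · simp only [bound]; omega
      · simpa [run, ht] using Exec.iteFalse ht h1
  | loop t c _ => exact h.elim

/-- `n` rounds of the loop with test `t` and body `c` lead from one state to another. -/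
inductive Rounds (t : Test) (c : Prog) : State → ℕ → State → Prop
  | refl (s : State) : Rounds t c s 0 s
  | step {s s' : State} {n : ℕ} : t.holds s → Rounds t c (c.run s) n s' → Rounds t c s (n + 1) s'

theorem Rounds.trans {t : Test} {c : Prog} {s s' s'' : State} {m n : ℕ} (h : Rounds t c s m s')
    (h' : Rounds t c s' n s'') : Rounds t c s (m + n) s'' := by
  induction h with
  | refl _ => simpa using h'
  | step ht _ ih => rw [Nat.add_right_comm]; exact .step ht (ih h')

theorem Rounds.exec {t : Test} {c : Prog} {s s' : State} {n : ℕ} (h : Rounds t c s n s')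
    (hc : c.LoopFree) (hs' : ¬ t.holds s') :
    ∃ k ≤ (n + 1) * (t.cost + c.bound), Exec (.loop t c) s k s' := by
  induction h with
  | refl s => exact ⟨t.cost, by omega, .loopDone hs'⟩
  | step ht _ ih =>
    obtain ⟨k, hk, h1⟩ := hc.exec_run _
    obtain ⟨k', hk', h2⟩ := ih hs'
    exact ⟨_, by rw [add_mul, one_mul, add_comm]; omega, .loopStep ht h1 h2⟩

/-- The program writes only to the array `10` and to the cells of the arrays from `12` on that are
addressed by the variable `2`, and does not change the first six variables. -/
def Prog.Local : Prog → Prop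
  | .skip => True
  | .assign x _ => 5 < x
  | .write a i _ => a = 10 ∨ 11 < a ∧ i = .var 2
  | .assignReal _ _ => False
  | .seq c d => c.Local ∧ d.Local
  | .ite _ c d => c.Local ∧ d.Local
  | .loop _ _ => False

/-- Applied to `finishProg`: finishing one node preserves the stored tree, the recorded parents and
the states of all other nodes. -/
theorem Prog.Local.frame {c : Prog} (h : c.Local) (s : State) :
    (∀ x ≤ 5, (c.run s).reg x = s.reg x) ∧
      (∀ a < 12, a ≠ 10 → (c.run s).arr a = s.arr a) ∧
      ∀ a > 10, ∀ i ≠ s.reg 2, (c.run s).arr a i = s.arr a i := by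
  induction c generalizing s with
  | skip => exact ⟨fun _ _ => rfl, fun _ _ _ => rfl, fun _ _ _ _ => rfl⟩
  | assign x e =>
    refine ⟨fun y hy => ?_, fun _ _ _ => rfl, fun _ _ _ _ => rfl⟩
    have : 5 < x := h
    exact Function.update_of_ne (by omega) _ _
  | write a i e =>
    refine ⟨fun _ _ => rfl, fun b hb hb' => ?_, fun b hb j hj => ?_⟩
    · exact Function.update_of_ne (by rcases h with h | h <;> omega) _ _
    · rcases h with rfl | ⟨h, rfl⟩
      · exact congrFun (Function.update_of_ne (by omega) _ _) j
      · by_cases e : b = a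
        · subst e
          simp [run, State.setArr, NatExp.eval, hj]
        · exact congrFun (Function.update_of_ne e _ _) j
  | assignReal x e => exact h.elim
  | seq c d ihc ihd =>
    obtain ⟨h1, h2, h3⟩ := ihc h.1 s
    obtain ⟨h1', h2', h3'⟩ := ihd h.2 (c.run s)
    refine ⟨fun x hx => (h1' x hx).trans (h1 x hx), fun a ha ha' => (h2' a ha ha').trans (h2 a ha ha'),
      fun a ha i hi => ?_⟩
    exact (h3' a ha i (by rwa [h1 2 (by omega)])).trans (h3 a ha i hi)
  | ite t c d ihc ihd =>
    rw [run]
    split_ifs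
    exacts [ihc h.1 s, ihd h.2 s]
  | loop t c _ => exact h.elim

/-! ### The program

Variables: `1` the leaf at which the tree is rooted, `2` the current node, `3` the previous one,
`4` whether the walk comes back from a child (`1`) or from the parent (`0`), `5` the next node,
`6` the left child.

Arrays: `10` the selection, `11` the parent, `12` the kind of the state of the subtree; `13` its only
marked leaf, `14` the address plus one of the record of the parent in the neighborhood of that leaf
(or `0`); `15` and `16` the numbers of leaves pending on the left and on the right, `17` and `18` the
topmost of these. -/

/-- The node after `y` around `x` goes to the variable `d`. -/
def rotProg (d : ℕ) (x y : NatExp) : Prog :=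
  .ite (.eq (.read 1 x) y) (.assign d (.read 2 x))
    (.ite (.eq (.read 2 x) y) (.assign d (.read 3 x)) (.assign d (.read 1 x)))

/-- Follow a link: variable `7` holds the address plus one of the record of the current node. -/
def climbProg : Prog :=
  .ite (.eq (.var 7) (.const 0)) (.write 14 (.var 2) (.const 0))
    (.ite (.eq (.read 1 (.var 2)) (.var 5))
      (.write 14 (.var 2) (.read 7 (.sub (.var 7) (.const 1))))
      (.ite (.eq (.read 2 (.var 2)) (.var 5))
        (.write 14 (.var 2) (.read 8 (.sub (.var 7) (.const 1))))
        (.write 14 (.var 2) (.read 9 (.sub (.var 7) (.const 1))))))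

def leafProg : Prog :=
  .ite (.eq (.read 4 (.var 2)) (.const 1))
    (.seq (.seq (.write 12 (.var 2) (.const 1)) (.seq (.write 13 (.var 2) (.var 2))
      (.assign 7 (.add (.read 5 (.var 2)) (.const 1))))) climbProg)
    (.write 12 (.var 2) (.const 0))

/-- Copy the state of the child `x`. -/
def copyProg (x : NatExp) : Prog :=
  .seq (.write 12 (.var 2) (.read 12 x)) (.seq (.write 13 (.var 2) (.read 13 x))
    (.seq (.write 15 (.var 2) (.read 15 x)) (.seq (.write 16 (.var 2) (.read 16 x))
      (.seq (.write 17 (.var 2) (.read 17 x)) (.seq (.write 18 (.var 2) (.read 18 x))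
        (.assign 7 (.read 14 x)))))))

/-- The current subtree inherits the state of the child `x`. -/
def inheritProg (x : NatExp) : Prog := .seq (copyProg x) climbProg

/-- Select the leaf `x`. -/
def selectProg (x : NatExp) : Prog := .write 10 x (.const 1)

/-- No leaf of the current subtree is pending. -/
def resetProg : Prog :=
  .seq (.write 12 (.var 2) (.const 2)) (.seq (.write 15 (.var 2) (.const 0))
    (.write 16 (.var 2) (.const 0)))

/-- The only marked leaf of the child `x` meets the leaves pending in the child `y` on the same side,
which is described by the arrays `n` and `l`; the arrays `n'` and `l'` describe the other side. -/
def pushProg (x y : NatExp) (n l n' l' : ℕ) : Prog :=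
  .ite (.eq (.read 14 x) (.const 0)) (.seq (selectProg (.read 13 x)) resetProg)
    (.ite (.le (.const 2) (.read n y)) (.seq (selectProg (.read l y)) resetProg)
      -- Only the topmost pending leaf of a side can be selected, so one label and a count per side
      -- suffice.
      (.seq (.write 12 (.var 2) (.const 2)) (.seq (.write n (.var 2) (.add (.read n y) (.const 1)))
        (.seq (.write l (.var 2) (.read 13 x)) (.seq (.write n' (.var 2) (.read n' y))
          (.write l' (.var 2) (.read l' y)))))))

/-- Combine the states of the left child (variable `6`) and of the right child (variable `3`). -/
def combineProg : Prog :=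
  .ite (.eq (.read 12 (.var 6)) (.const 0)) (inheritProg (.var 3))
    (.ite (.eq (.read 12 (.var 3)) (.const 0)) (inheritProg (.var 6))
      (.ite (.eq (.read 12 (.var 6)) (.const 1))
        (.ite (.eq (.read 12 (.var 3)) (.const 1))
          (.seq (.ite (.eq (.read 14 (.var 6)) (.const 0)) (selectProg (.read 13 (.var 6)))
            (selectProg (.read 13 (.var 3)))) resetProg)
          (pushProg (.var 6) (.var 3) 15 17 16 18))
        (.ite (.eq (.read 12 (.var 3)) (.const 1)) (pushProg (.var 3) (.var 6) 16 18 15 17)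
          resetProg)))

def finishProg : Prog :=
  .ite (.eq (.read 0 (.var 2)) (.const 1)) leafProg
    (.seq (rotProg 6 (.var 2) (.var 5)) combineProg)

/-- Record the parent of a node that is met for the first time. -/
def parentProg : Prog := .ite (.eq (.var 4) (.const 0)) (.write 11 (.var 2) (.var 3)) .skip

/-- One step of the walk. -/
def stepProg : Prog :=
  .seq parentProg
    (.seq (rotProg 5 (.var 2) (.var 3))
      -- The next node is the parent exactly when all children have been dealt with; variable `3` is
      -- then the right child, if there is one.
      (.seq (.ite (.eq (.var 5) (.read 11 (.var 2))) (.seq finishProg (.assign 4 (.const 1)))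
          (.assign 4 (.const 0)))
        (.seq (.assign 3 (.var 2)) (.assign 2 (.var 5)))))

def outputProg : Prog :=
  .ite (.eq (.read 12 (.var 3)) (.const 0)) (.write 10 (.var 1) (.read 4 (.var 1)))
    (.ite (.eq (.read 12 (.var 3)) (.const 1)) (selectProg (.read 13 (.var 3))) .skip)

def rootTest : Test := .not (.eq (.read 0 (.var 1)) (.const 1))

def rootProg : Prog := .assign 1 (.add (.var 1) (.const 1))

def walkTest : Test := .not (.eq (.var 2) (.var 1))

def selectionProg : Prog :=
  .seq (.loop rootTest rootProg)
    (.seq (.assign 2 (.read 1 (.var 1))) (.seq (.assign 3 (.var 1))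
      (.seq (.loop walkTest stepProg) outputProg)))

theorem finishProg_local : finishProg.Local := by
  simp [finishProg, leafProg, combineProg, Prog.Local, climbProg, inheritProg, copyProg, selectProg,
    resetProg, pushProg, rotProg]

theorem stepProg_loopFree : stepProg.LoopFree := by
  simp [stepProg, parentProg, finishProg, leafProg, combineProg, Prog.LoopFree, climbProg, inheritProg,
    copyProg, selectProg, resetProg, pushProg, rotProg]

/-! ### Correctness -/

section

variable {N : ℕ} {T : MarkedTree (Fin N)} {arr : ℕ → ℕ → ℕ} {h : Fin N → Fin N → ℕ} {s : State}
  {u v a b : Fin N}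

theorem Stores.eq_nbr (hS : Stores T arr h) (huv : T.graph.Adj v u) :
    arr 1 v = u ∨ arr 2 v = u ∨ arr 3 v = u := by
  obtain ⟨w, hw, h1, h2, h3⟩ := hS.nbr v
  rcases T.proper v with hv | hv
  · rw [h1, T.eq_of_adj_of_leaf hv huv hw]; exact .inl rfl
  · rcases (T.rot_node hv hw).2.2.2 u huv with rfl | rfl | rfl <;> simp [*]

/-- The three stored neighbors are in cyclic order; at a leaf they coincide and the first comparison
succeeds. -/
theorem Stores.rotProg_run (hS : Stores T arr h) (hs : ∀ i < 10, s.arr i = arr i) (d : ℕ)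
    {x y : NatExp} (hx : x.eval s = v) (hy : y.eval s = u) (huv : T.graph.Adj v u) :
    (rotProg d x y).run s = s.setReg d (T.rot v u) := by
  obtain ⟨w, hw, h1, h2, h3⟩ := hS.nbr v
  have key : (if arr 1 v = u then arr 2 v else if arr 2 v = u then arr 3 v else arr 1 v) =
      T.rot v u := by
    rw [h1, h2, h3]
    simp only [Fin.val_inj]
    rcases T.proper v with hv | hv
    · obtain rfl := T.eq_of_adj_of_leaf hv huv hw
      simp
    · obtain ⟨h1, h2, h3, h4⟩ := T.rot_node hv hw
      rcases h4 u huv with rfl | rfl | rfl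
      · simp
      · simp [h1.symm]
      · simp [h1.symm, h2.symm, h3]
  rw [← key]
  simp only [rotProg, Prog.run, Test.holds, NatExp.eval, hx, hy, hs 1 (by omega), hs 2 (by omega),
    hs 3 (by omega)]
  split_ifs <;> rfl

/-- The arrays hold the state of the subtree rooted at `x`, whose parent is `v`. -/
def Holds (T : MarkedTree (Fin N)) (h : Fin N → Fin N → ℕ) (arr : ℕ → ℕ → ℕ) (v x : Fin N) :
    Status (Fin N) → Prop
  | .empty => arr 12 x = 0
  | .one l => arr 12 x = 1 ∧ arr 13 x = l ∧
      (v ∈ T.nh l → arr 14 x = h l v + 1) ∧ (v ∉ T.nh l → arr 14 x = 0)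
  | .many p q => arr 12 x = 2 ∧ arr 15 x = p.length ∧ arr 16 x = q.length ∧
      (∀ l ∈ p.head?, arr 17 x = l) ∧ ∀ l ∈ q.head?, arr 18 x = l

theorem Holds.congr {arr' : ℕ → ℕ → ℕ} {st : Status (Fin N)} (hh : Holds T h arr v a st)
    (hr : ∀ i > 10, arr' i a = arr i a) : Holds T h arr' v a st := by
  cases st <;> simpa [Holds, hr] using hh

/-- What `climbProg` writes. -/
noncomputable def climb (s : State) : ℕ :=
  if s.reg 7 = 0 then 0 else if s.arr 1 (s.reg 2) = s.reg 5 then s.arr 7 (s.reg 7 - 1)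
    else if s.arr 2 (s.reg 2) = s.reg 5 then s.arr 8 (s.reg 7 - 1) else s.arr 9 (s.reg 7 - 1)

theorem climbProg_run : climbProg.run s = s.setArr 14 (s.reg 2) (climb s) := by
  by_cases h7 : s.reg 7 = 0
  · simp [climbProg, Prog.run, Test.holds, NatExp.eval, climb, h7]
  by_cases h1 : s.arr 1 (s.reg 2) = s.reg 5
  · simp [climbProg, Prog.run, Test.holds, NatExp.eval, climb, h7, h1]
  by_cases h2 : s.arr 2 (s.reg 2) = s.reg 5 <;>
    simp [climbProg, Prog.run, Test.holds, NatExp.eval, climb, h7, h1, h2]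

/-- Following one link moves the pointer from `v` to `u`. By `hu`, a neighborhood that has been left
is not entered again, so a null pointer may stay null. -/
theorem Stores.climb_eq (hS : Stores T arr h) (hs : ∀ i < 10, s.arr i = arr i) {l : Fin N}
    (hl : l ∈ T.marked) (h2 : s.reg 2 = v) (h5 : s.reg 5 = u) (huv : T.graph.Adj v u)
    (hv : v ∈ T.nh l → s.reg 7 = h l v + 1) (hv' : v ∉ T.nh l → s.reg 7 = 0)
    (hu : u ∈ T.nh l → v ∈ T.nh l) :
    (u ∈ T.nh l → climb s = h l u + 1) ∧ (u ∉ T.nh l → climb s = 0) := by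
  by_cases hvl : v ∈ T.nh l
  · have key : ∃ i < 3, arr (1 + i) v = u ∧ climb s = arr (7 + i) (h l v) := by
      simp only [climb, hv hvl, h2, h5, hs 1 (by omega), hs 2 (by omega), hs 7 (by omega),
        hs 8 (by omega), hs 9 (by omega)]
      by_cases h1 : arr 1 v = u
      · exact ⟨0, by omega, h1, by simp [h1]⟩
      by_cases h2 : arr 2 v = u
      · exact ⟨1, by omega, h2, by simp [h1, h2]⟩
      have h3 := ((hS.eq_nbr huv).resolve_left h1).resolve_left h2
      exact ⟨2, by omega, h3, by simp [h1, h2]⟩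
    obtain ⟨i, hi, h3, h4⟩ := key
    rw [h4]
    exact hS.link l hl v hvl i hi u h3
  · exact ⟨fun h => absurd (hu h) hvl, fun _ => by simp [climb, hv' hvl]⟩

theorem Stores.climbProg_holds (hS : Stores T arr h) (hs : ∀ i < 10, s.arr i = arr i)
    {l : Fin N} (hl : l ∈ T.marked) (h2 : s.reg 2 = v) (h5 : s.reg 5 = u)
    (huv : T.graph.Adj v u) (h12 : s.arr 12 v = 1) (h13 : s.arr 13 v = l)
    (hv : v ∈ T.nh l → s.reg 7 = h l v + 1) (hv' : v ∉ T.nh l → s.reg 7 = 0)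
    (hu : u ∈ T.nh l → v ∈ T.nh l) : Holds T h (climbProg.run s).arr u v (.one l) := by
  rw [climbProg_run]
  have := hS.climb_eq hs hl h2 h5 huv hv hv' hu
  simpa [Holds, State.setArr, h2, h12, h13] using this

theorem Stores.leafProg_run (hS : Stores T arr h) (hs : ∀ i < 10, s.arr i = arr i)
    (h2 : s.reg 2 = v) (h5 : s.reg 5 = u) (huv : T.graph.Adj v u) :
    Holds T h (leafProg.run s).arr u v (T.status (.leaf v)) ∧
      (leafProg.run s).arr 10 = s.arr 10 := by
  by_cases hm : v ∈ T.marked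
  · have h4 := (hS.marked v).1 hm
    have hvv := T.mem_nh v hm
    simp only [leafProg, Prog.run, Test.holds, NatExp.eval, h2, hs 4 (by omega), h4, if_true,
      MarkedTree.status, hm]
    refine ⟨hS.climbProg_holds ?_ hm ?_ ?_ huv ?_ ?_ ?_ (absurd hvv) fun _ => hvv, ?_⟩
    · intro i hi
      simp [State.setArr, State.setReg, hs i hi, Function.update_of_ne (show i ≠ 12 by omega),
        Function.update_of_ne (show i ≠ 13 by omega)]
    all_goals simp [climbProg_run, State.setArr, State.setReg, h2, h5, hs, hS.root v hm]
  · have h4 := (hS.marked v).2 hm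
    simp [leafProg, Prog.run, Test.holds, NatExp.eval, h2, hs, h4, State.setArr, Holds,
      MarkedTree.status, hm]

theorem copyProg_local {x : NatExp} : (copyProg x).Local := by
  simp [copyProg, Prog.Local]

/-- Only in the state `one` does the climbed pointer matter; in the other states array `14` is not
part of the description. -/
theorem Stores.inheritProg_run (hS : Stores T arr h) (hs : ∀ i < 10, s.arr i = arr i)
    (h2 : s.reg 2 = v) (h5 : s.reg 5 = u) (huv : T.graph.Adj v u) {x : ℕ} (hx : s.reg x = a)
    {st : Status (Fin N)} (ha : Holds T h s.arr v a st)
    (hl : ∀ l, st = .one l → l ∈ T.marked ∧ (u ∈ T.nh l → v ∈ T.nh l)) :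
    Holds T h ((inheritProg (.var x)).run s).arr u v st ∧
      ((inheritProg (.var x)).run s).arr 10 = s.arr 10 := by
  have hfr := copyProg_local.frame (c := copyProg (.var x)) s
  have hcopy : ∀ i ∈ [12, 13, 15, 16, 17, 18],
      ((copyProg (.var x)).run s).arr i v = s.arr i a := by
    simp [copyProg, Prog.run, NatExp.eval, State.setArr, State.setReg, h2, hx]
  have h7 : ((copyProg (.var x)).run s).reg 7 = s.arr 14 a := by
    simp [copyProg, Prog.run, NatExp.eval, State.setArr, State.setReg, h2, hx]
  have h10 : ((copyProg (.var x)).run s).arr 10 = s.arr 10 := by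
    simp [copyProg, Prog.run, NatExp.eval, State.setArr, State.setReg]
  simp only [inheritProg, Prog.run]
  generalize (copyProg (.var x)).run s = s' at *
  refine ⟨?_, by simpa [climbProg_run, State.setArr] using h10⟩
  cases st with
  | empty => simpa [Holds, climbProg_run, State.setArr, hcopy] using ha
  | many p q => simpa [Holds, climbProg_run, State.setArr, hcopy] using ha
  | one l =>
    obtain ⟨h12, h13, h14, h14'⟩ := ha
    exact hS.climbProg_holds (fun i hi => (hfr.2.1 i (by omega) (by omega)).trans (hs i hi))
      (hl l rfl).1 ((hfr.1 2 (by omega)).trans h2) ((hfr.1 5 (by omega)).trans h5) huv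
      ((hcopy 12 (by simp)).trans h12) ((hcopy 13 (by simp)).trans h13)
      (fun hv => h7.trans (h14 hv)) (fun hv => h7.trans (h14' hv)) (hl l rfl).2

theorem select_reset_run {x : NatExp} {l : Fin N} (h2 : s.reg 2 = v) (hx : x.eval s = l) :
    Holds T h ((Prog.seq (selectProg x) resetProg).run s).arr u v (.many [] []) ∧
      ∀ y : Fin N, ((Prog.seq (selectProg x) resetProg).run s).arr 10 y ≠ 0 ↔
        s.arr 10 y ≠ 0 ∨ some l = some y := by
  refine ⟨by simp [Prog.run, selectProg, resetProg, Holds, State.setArr, NatExp.eval, h2],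
    fun y => ?_⟩
  by_cases hy : y = l
  · simp [Prog.run, selectProg, resetProg, State.setArr, NatExp.eval, hx, hy]
  · have hy' : (y : ℕ) ≠ l := fun e => hy (Fin.ext e)
    simp [Prog.run, selectProg, resetProg, State.setArr, NatExp.eval, hx, hy', Ne.symm hy]

/-- The effect of `combineProg`. -/
theorem Stores.combineProg_run (hS : Stores T arr h) (hs : ∀ i < 10, s.arr i = arr i)
    (h2 : s.reg 2 = v) (h3 : s.reg 3 = b) (h5 : s.reg 5 = u) (h6 : s.reg 6 = a)
    (huv : T.graph.Adj v u) {sa sb : Status (Fin N)}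
    (ha : Holds T h s.arr v a sa) (hb : Holds T h s.arr v b sb)
    (hla : ∀ l, sa = .one l → l ∈ T.marked ∧ (u ∈ T.nh l → v ∈ T.nh l))
    (hlb : ∀ l, sb = .one l → l ∈ T.marked ∧ (u ∈ T.nh l → v ∈ T.nh l)) :
    Holds T h (combineProg.run s).arr u v (T.combine v sa sb).1 ∧
      ∀ y : Fin N, (combineProg.run s).arr 10 y ≠ 0 ↔
        s.arr 10 y ≠ 0 ∨ (T.combine v sa sb).2 = some y := by
  match sa, sb, ha, hb with
  | .empty, sb, ha, hb =>
    have e : combineProg.run s = (inheritProg (.var 3)).run s := by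
      simp [combineProg, Prog.run, Test.holds, NatExp.eval, h6, show s.arr 12 a = 0 from ha]
    obtain ⟨h7, h8⟩ := hS.inheritProg_run hs h2 h5 huv h3 hb hlb
    rw [e, h8]
    exact ⟨by simpa [MarkedTree.combine] using h7, by simp [MarkedTree.combine]⟩
  | .one l, .empty, ha, hb =>
    have e : combineProg.run s = (inheritProg (.var 6)).run s := by
      simp [combineProg, Prog.run, Test.holds, NatExp.eval, h6, h3, ha.1,
        show s.arr 12 b = 0 from hb]
    obtain ⟨h7, h8⟩ := hS.inheritProg_run hs h2 h5 huv h6 ha hla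
    rw [e, h8]
    exact ⟨by simpa [MarkedTree.combine] using h7, by simp [MarkedTree.combine]⟩
  | .many p q, .empty, ha, hb =>
    have e : combineProg.run s = (inheritProg (.var 6)).run s := by
      simp [combineProg, Prog.run, Test.holds, NatExp.eval, h6, h3, ha.1,
        show s.arr 12 b = 0 from hb]
    obtain ⟨h7, h8⟩ := hS.inheritProg_run hs h2 h5 huv h6 ha hla
    rw [e, h8]
    exact ⟨by simpa [MarkedTree.combine] using h7, by simp [MarkedTree.combine]⟩
  | .one l, .one l', ⟨a12, a13, a14, a14'⟩, ⟨b12, b13, _, _⟩ =>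
    by_cases hv : v ∈ T.nh l
    · have e : combineProg.run s = (Prog.seq (selectProg (.read 13 (.var 3))) resetProg).run s := by
        simp [combineProg, Prog.run, Test.holds, NatExp.eval, h6, h3, a12, b12, a14 hv]
      rw [e]
      simpa only [MarkedTree.combine, if_pos hv] using
        select_reset_run h2 (by simp [NatExp.eval, h3, b13])
    · have e : combineProg.run s = (Prog.seq (selectProg (.read 13 (.var 6))) resetProg).run s := by
        simp [combineProg, Prog.run, Test.holds, NatExp.eval, h6, h3, a12, b12, a14' hv]
      rw [e]
      simpa only [MarkedTree.combine, if_neg hv] using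
        select_reset_run h2 (by simp [NatExp.eval, h6, a13])
  | .many p q, .many p' q', ha, hb =>
    simp [combineProg, Prog.run, Test.holds, NatExp.eval, h6, h3, h2, ha.1, hb.1,
      MarkedTree.combine, resetProg, State.setArr, Holds]
  | .one l, .many p q, ⟨a12, a13, a14, a14'⟩, ⟨b12, b15, b16, b17, b18⟩ =>
    have e : combineProg.run s = (pushProg (.var 6) (.var 3) 15 17 16 18).run s := by
      simp [combineProg, Prog.run, Test.holds, NatExp.eval, h6, h3, a12, b12]
    rw [e]
    by_cases hv : v ∈ T.nh l
    · by_cases hp : 2 ≤ p.length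
      · obtain ⟨x, y, r, rfl⟩ : ∃ x y r, p = x :: y :: r := by
          match p, hp with
          | x :: y :: r, _ => exact ⟨x, y, r, rfl⟩
        have e : (pushProg (.var 6) (.var 3) 15 17 16 18).run s =
            (Prog.seq (selectProg (.read 17 (.var 3))) resetProg).run s := by
          simp [pushProg, Prog.run, Test.holds, NatExp.eval, h6, h3, a14 hv, b15]
        rw [e]
        simpa [MarkedTree.combine, MarkedTree.push, hv] using
          select_reset_run h2 (by simp [NatExp.eval, h3, b17])
      · have hpush : T.push v l p = .inr (l :: p) := by
          match p, hp with
          | [], _ => simp [MarkedTree.push, hv]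
          | [_], _ => simp [MarkedTree.push, hv]
          | _ :: _ :: _, hp => simp at hp
        simp [MarkedTree.combine, hpush, pushProg, Prog.run, Test.holds, NatExp.eval, h6, h3, h2,
          a14 hv, a13, b15, hp, State.setArr, Holds, b16]
        simpa using b18
    · have e : (pushProg (.var 6) (.var 3) 15 17 16 18).run s =
          (Prog.seq (selectProg (.read 13 (.var 6))) resetProg).run s := by
        simp [pushProg, Prog.run, Test.holds, NatExp.eval, h6, a14' hv]
      rw [e]
      simpa [MarkedTree.combine, MarkedTree.push, hv] using
        select_reset_run h2 (by simp [NatExp.eval, h6, a13])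
  | .many p q, .one l, ⟨a12, a15, a16, a17, a18⟩, ⟨b12, b13, b14, b14'⟩ =>
    have e : combineProg.run s = (pushProg (.var 3) (.var 6) 16 18 15 17).run s := by
      simp [combineProg, Prog.run, Test.holds, NatExp.eval, h6, h3, a12, b12]
    rw [e]
    by_cases hv : v ∈ T.nh l
    · by_cases hp : 2 ≤ q.length
      · obtain ⟨x, y, r, rfl⟩ : ∃ x y r, q = x :: y :: r := by
          match q, hp with
          | x :: y :: r, _ => exact ⟨x, y, r, rfl⟩
        have e : (pushProg (.var 3) (.var 6) 16 18 15 17).run s =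
            (Prog.seq (selectProg (.read 18 (.var 6))) resetProg).run s := by
          simp [pushProg, Prog.run, Test.holds, NatExp.eval, h6, h3, b14 hv, a16]
        rw [e]
        simpa [MarkedTree.combine, MarkedTree.push, hv] using
          select_reset_run h2 (by simp [NatExp.eval, h6, a18])
      · have hpush : T.push v l q = .inr (l :: q) := by
          match q, hp with
          | [], _ => simp [MarkedTree.push, hv]
          | [_], _ => simp [MarkedTree.push, hv]
          | _ :: _ :: _, hp => simp at hp
        simp [MarkedTree.combine, hpush, pushProg, Prog.run, Test.holds, NatExp.eval, h6, h3, h2,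
          b14 hv, b13, a15, hp, State.setArr, Holds, a16]
        simpa using a17
    · have e : (pushProg (.var 3) (.var 6) 16 18 15 17).run s =
          (Prog.seq (selectProg (.read 13 (.var 3))) resetProg).run s := by
        simp [pushProg, Prog.run, Test.holds, NatExp.eval, h3, b14' hv]
      rw [e]
      simpa [MarkedTree.combine, MarkedTree.push, hv] using
        select_reset_run h2 (by simp [NatExp.eval, h3, b13])

/-- The first part of `stepProg`: the parent is recorded and the next node is found. -/
theorem Stores.exists_stepProg_run (hS : Stores T arr h) (hs : ∀ i < 10, s.arr i = arr i)
    {x : Fin N} (h2 : s.reg 2 = v) (h3 : s.reg 3 = x) (hvx : T.graph.Adj v x)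
    (h4 : s.reg 4 = 0 ∧ x = u ∨ s.reg 4 = 1 ∧ s.arr 11 v = u) :
    ∃ s₁ : State, s₁.reg 1 = s.reg 1 ∧ s₁.reg 2 = v ∧ s₁.reg 3 = x ∧ s₁.reg 5 = T.rot v x ∧
      s₁.arr 11 v = u ∧ (∀ i ≠ 11, s₁.arr i = s.arr i) ∧
      (∀ j ≠ (v : ℕ), s₁.arr 11 j = s.arr 11 j) ∧
      (T.rot v x ≠ u → stepProg.run s = ((s₁.setReg 4 0).setReg 3 v).setReg 2 (T.rot v x)) ∧
      (T.rot v x = u → stepProg.run s =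
        (((finishProg.run s₁).setReg 4 1).setReg 3 v).setReg 2 u) := by
  obtain ⟨s₀, h0, e0, h1', h3', h4'⟩ : ∃ s₀ : State, s₀ = parentProg.run s ∧ s₀.reg = s.reg ∧
      s₀.arr 11 v = u ∧ (∀ i ≠ 11, s₀.arr i = s.arr i) ∧ ∀ j ≠ (v : ℕ), s₀.arr 11 j = s.arr 11 j := by
    refine ⟨_, rfl, ?_⟩
    rcases h4 with ⟨h4, rfl⟩ | ⟨h4, h5⟩
    · simp +contextual [parentProg, Prog.run, Test.holds, NatExp.eval, h4, State.setArr, h2, h3]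
    · simp [parentProg, Prog.run, Test.holds, NatExp.eval, h4, h5]
  have hrot := hS.rotProg_run (s := s₀) (fun i hi => (h3' i (by omega)).trans (hs i hi)) 5
    (x := .var 2) (y := .var 3) (by simp [NatExp.eval, e0, h2]) (by simp [NatExp.eval, e0, h3]) hvx
  have hl := finishProg_local.frame (s₀.setReg 5 (T.rot v x))
  refine ⟨s₀.setReg 5 (T.rot v x), by simp [State.setReg, e0], by simp [State.setReg, e0, h2],
    by simp [State.setReg, e0, h3], by simp [State.setReg], h1', h3', h4', fun hu => ?_,
    fun hu => ?_⟩
  · have hu' : (T.rot v x : ℕ) ≠ u := fun e => hu (Fin.ext e)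
    simp [stepProg, Prog.run, ← h0, hrot, Test.holds, NatExp.eval, State.setReg, e0, h2, h1', hu']
  · have h2' := hl.1 2 (by omega)
    have h5' := hl.1 5 (by omega)
    simp only [State.setReg, e0] at h2' h5'
    simp [h2, hu] at h2' h5'
    simp [stepProg, Prog.run, ← h0, hrot, Test.holds, NatExp.eval, State.setReg, e0, h2, h1', hu,
      h2', h5']

theorem Stores.finishProg_run_leaf (hS : Stores T arr h) (hs : ∀ i < 10, s.arr i = arr i)
    (hv : (T.graph.neighborSet v).ncard = 1) (h2 : s.reg 2 = v) (h5 : s.reg 5 = u)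
    (huv : T.graph.Adj v u) :
    Holds T h (finishProg.run s).arr u v (T.status (.leaf v)) ∧
      (finishProg.run s).arr 10 = s.arr 10 := by
  have e : finishProg.run s = leafProg.run s := by
    simp [finishProg, Prog.run, Test.holds, NatExp.eval, h2, hs, hS.degree, hv]
  rw [e]
  exact hS.leafProg_run hs h2 h5 huv

theorem Stores.finishProg_run_node (hS : Stores T arr h) (hs : ∀ i < 10, s.arr i = arr i)
    (hv : (T.graph.neighborSet v).ncard = 3) (h2 : s.reg 2 = v) (h3 : s.reg 3 = b)
    (h5 : s.reg 5 = u) (huv : T.graph.Adj v u) {sa sb : Status (Fin N)}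
    (ha : Holds T h s.arr v (T.rot v u) sa) (hb : Holds T h s.arr v b sb)
    (hla : ∀ l, sa = .one l → l ∈ T.marked ∧ (u ∈ T.nh l → v ∈ T.nh l))
    (hlb : ∀ l, sb = .one l → l ∈ T.marked ∧ (u ∈ T.nh l → v ∈ T.nh l)) :
    Holds T h (finishProg.run s).arr u v (T.combine v sa sb).1 ∧
      ∀ y : Fin N, (finishProg.run s).arr 10 y ≠ 0 ↔
        s.arr 10 y ≠ 0 ∨ (T.combine v sa sb).2 = some y := by
  have e : finishProg.run s = combineProg.run (s.setReg 6 (T.rot v u)) := by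
    rw [← hS.rotProg_run hs 6 (x := .var 2) (y := .var 5) h2 h5 huv]
    simp [finishProg, Prog.run, Test.holds, NatExp.eval, h2, hs, hS.degree, hv]
  rw [e]
  exact hS.combineProg_run (s := s.setReg 6 (T.rot v u)) hs (by simpa [State.setReg] using h2)
    (by simpa [State.setReg] using h3) (by simpa [State.setReg] using h5) (by simp [State.setReg])
    huv ha hb hla hlb

/-- Connectedness of `nh l`: from `l` below `v`, a node outside the subtree is reached only through
`v`. This supplies the hypothesis under which pointers climb. -/
theorem mem_nh_of_status_eq_one {f : Fin N → ℕ} {t : BinTree (Fin N)} {l : Fin N}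
    (ht : T.Rooted f v a t) (hl : T.status t = .one l) :
    l ∈ T.marked ∧ (u ∈ T.nh l → u ∉ t.support → v ∈ T.nh l) := by
  have h1 := (MarkedTree.status_spec ht).2
  rw [hl] at h1
  obtain ⟨h2, h3⟩ := BinTree.mem_of_mem_among (h1.1 ▸ List.mem_singleton_self l)
  refine ⟨h2, fun hu hut => by_contra fun hv => hut ?_⟩
  exact MarkedTree.nh_subset_support ht h2 h3 hv hu

/-- The walk around the part of the tree seen from `u` through `v`. -/
theorem Stores.rounds (hS : Stores T arr h) {f : Fin N → ℕ} {t : BinTree (Fin N)}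
    (ht : T.Rooted f u v t) {r : Fin N} (hr : r ∉ t.support) (hs : ∀ i < 10, s.arr i = arr i)
    (h1 : s.reg 1 = r) (h2 : s.reg 2 = v) (h3 : s.reg 3 = u) (h4 : s.reg 4 = 0) :
    ∃ s', Rounds walkTest stepProg s t.tour.length s' ∧ (∀ i < 10, s'.arr i = arr i) ∧
      s'.reg 1 = r ∧ s'.reg 2 = u ∧ s'.reg 3 = v ∧ s'.reg 4 = 1 ∧
      Holds T h s'.arr u v (T.status t) ∧
      (∀ i > 10, ∀ x : Fin N, x ∉ t.support → s'.arr i x = s.arr i x) ∧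
      ∀ y : Fin N, s'.arr 10 y ≠ 0 ↔ s.arr 10 y ≠ 0 ∨ y ∈ T.selected t := by
  induction ht generalizing s with
  | @leaf u v hu hv _ =>
    have hvr : (v : ℕ) ≠ r := fun e => hr (Fin.ext e.symm)
    obtain ⟨s₁, a1, a2, a3, a5, a11, a, a', -, hstep⟩ :=
      hS.exists_stepProg_run hs h2 h3 hu (.inl ⟨h4, rfl⟩)
    have hrot := T.rot_leaf hv hu
    have hs₁ : ∀ i < 10, s₁.arr i = arr i := fun i hi => (a i (by omega)).trans (hs i hi)
    obtain ⟨b1, b2⟩ := hS.finishProg_run_leaf hs₁ hv a2 (a5.trans (by rw [hrot])) hu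
    obtain ⟨f1, f2, f3⟩ := finishProg_local.frame s₁
    refine ⟨stepProg.run s, .step (by simp [walkTest, Test.holds, NatExp.eval, h2, h1, hvr])
      (.refl _), ?_⟩
    rw [hstep hrot]
    simp only [State.setReg]
    refine ⟨fun i hi => (f2 i (by omega) (by omega)).trans (hs₁ i hi), ?_, by simp, by simp,
      by simp, b1, fun i hi x hx => ?_, fun y => ?_⟩
    · simp [f1, a1, h1]
    · have hx' : (x : ℕ) ≠ v := fun e => hx (Fin.ext e)
      rw [f3 i hi x (by rwa [a2])]
      by_cases hi' : i = 11
      · rw [hi', a' x hx']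
      · rw [a i hi']
    · rw [b2, a 10 (by omega)]
      simp [MarkedTree.selected]
  | @node u v ta tb hu hv hd hta htb iha ihb =>
    obtain ⟨n1, n2, n3, -⟩ := T.rot_node hv hu
    have hvr : (v : ℕ) ≠ r := fun e => hr (Fin.ext e.symm ▸ .inl rfl)
    have hra : r ∉ ta.support := fun e => hr (.inr (.inl e))
    have hrb : r ∉ tb.support := fun e => hr (.inr (.inr e))
    have hut : u ∉ (BinTree.node v ta tb).support :=
      (PlaneBinaryTree.Rooted.node hu hv hd hta htb).notMem
    have hab := hta.disjoint htb fun e => (T.rot_node hv (T.adj_rot hu)).1 e.symm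
    have hw : ∀ s : State, s.reg 1 = r → s.reg 2 = v → walkTest.holds s := fun s h1 h2 => by
      simp [walkTest, Test.holds, NatExp.eval, h2, h1, hvr]
    -- down to the left child
    obtain ⟨s₁, a1, -, -, -, a11, a, a', hstep, -⟩ :=
      hS.exists_stepProg_run hs h2 h3 hu (.inl ⟨h4, rfl⟩)
    have r1 := Rounds.step (hw s h1 h2) (.refl (t := walkTest) (c := stepProg) (stepProg.run s))
    rw [hstep n1] at r1
    obtain ⟨s₂, r2, b, b1, b2, b3, b4, bh, bf, bo⟩ := iha hra
      (s := ((s₁.setReg 4 0).setReg 3 v).setReg 2 (T.rot v u))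
      (fun i hi => (a i (by omega)).trans (hs i hi)) (by simp [State.setReg, a1, h1])
      (by simp [State.setReg]) (by simp [State.setReg]) (by simp [State.setReg])
    simp only [State.setReg] at bf bo
    -- down to the right child
    have b11 : s₂.arr 11 v = u := by rw [bf 11 (by omega) v hta.notMem, a11]
    obtain ⟨s₃, c1, -, -, -, c11, c, c', hstep, -⟩ :=
      hS.exists_stepProg_run b b2 b3 hta.adj.symm (.inr ⟨b4, b11⟩)
    have r3 := Rounds.step (hw s₂ b1 b2) (.refl (t := walkTest) (c := stepProg) (stepProg.run s₂))
    rw [hstep n2] at r3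
    obtain ⟨s₄, r4, d, d1, d2, d3, d4, dh, df, dout⟩ := ihb hrb
      (s := ((s₃.setReg 4 0).setReg 3 v).setReg 2 (T.rot v (T.rot v u)))
      (fun i hi => (c i (by omega)).trans (b i hi)) (by simp [State.setReg, c1, b1])
      (by simp [State.setReg]) (by simp [State.setReg]) (by simp [State.setReg])
    simp only [State.setReg] at df dout
    -- back to the parent
    have d11 : s₄.arr 11 v = u := by rw [df 11 (by omega) v htb.notMem, c11]
    obtain ⟨s₅, e1, e2, e3, e5, -, e, e', -, hstep⟩ :=
      hS.exists_stepProg_run d d2 d3 htb.adj.symm (.inr ⟨d4, d11⟩)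
    have r5 := Rounds.step (hw s₄ d1 d2) (.refl (t := walkTest) (c := stepProg) (stepProg.run s₄))
    rw [hstep n3] at r5
    have hne : ∀ x : Fin N, x ≠ v → (x : ℕ) ≠ v := fun x hx e => hx (Fin.ext e)
    have hframe₃ : ∀ i > 10, ∀ x : Fin N, x ≠ v → s₃.arr i x = s₂.arr i x := fun i _ x hx => by
      by_cases hi : i = 11
      · rw [hi, c' x (hne x hx)]
      · rw [c i hi]
    have hframe₅ : ∀ i > 10, ∀ x : Fin N, x ≠ v → s₅.arr i x = s₄.arr i x := fun i _ x hx => by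
      by_cases hi : i = 11
      · rw [hi, e' x (hne x hx)]
      · rw [e i hi]
    have hs₅ : ∀ i < 10, s₅.arr i = arr i := fun i hi => (e i (by omega)).trans (d i hi)
    -- The state of the left child has survived the tour of the right subtree, because the supports
    -- are disjoint.
    obtain ⟨g1, g2⟩ := hS.finishProg_run_node hs₅ hv e2 e3 (e5.trans (by rw [n3])) hu
      (bh.congr fun i hi => by
        rw [hframe₅ i hi _ hta.adj.ne, df i hi _ (Set.disjoint_left.1 hab hta.mem),
          hframe₃ i hi _ hta.adj.ne])
      (dh.congr fun i hi => hframe₅ i hi _ htb.adj.ne)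
      (fun l hl => (mem_nh_of_status_eq_one hta hl).imp_right fun h hul =>
        h hul fun hua => hut (.inr (.inl hua)))
      (fun l hl => (mem_nh_of_status_eq_one htb hl).imp_right fun h hul =>
        h hul fun hub => hut (.inr (.inr hub)))
    obtain ⟨f1, f2, f3⟩ := finishProg_local.frame s₅
    refine ⟨(((finishProg.run s₅).setReg 4 1).setReg 3 v).setReg 2 u, ?_, fun i hi => (f2 i (by omega) (by omega)).trans (hs₅ i hi), ?_, ?_, ?_, ?_, g1,
      fun i hi x hx => ?_, fun y => (g2 y).trans ?_⟩
    -- Three steps are made at `v`: to the left child, to the right child, and back to the parent.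
    · have hlen : (BinTree.node v ta tb).tour.length =
          0 + 1 + (ta.tour.length + (0 + 1 + (tb.tour.length + (0 + 1)))) := by
        simp only [BinTree.tour, List.length_cons, List.length_append, List.length_nil]
        omega
      rw [hlen]
      exact r1.trans (r2.trans (r3.trans (r4.trans r5)))
    · simp [State.setReg, f1, e1, d1]
    · simp [State.setReg]
    · simp [State.setReg]
    · simp [State.setReg]
    · have hxv : x ≠ v := fun e => hx (e ▸ .inl rfl)
      have hxa : x ∉ ta.support := fun e => hx (.inr (.inl e))
      have hxb : x ∉ tb.support := fun e => hx (.inr (.inr e))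
      refine (f3 i hi x (by rw [e2]; exact hne x hxv)).trans ?_
      rw [hframe₅ i hi x hxv, df i hi x hxb, hframe₃ i hi x hxv, bf i hi x hxa]
      by_cases hi' : i = 11
      · rw [hi', a' x (hne x hxv)]
      · rw [a i hi']
    · rw [e 10 (by omega), dout, c 10 (by omega), bo, a 10 (by omega)]
      simp only [MarkedTree.selected, Finset.mem_union, Option.mem_toFinset, Option.mem_def]
      tauto

end

end RAM

/-! ### The whole program: choice of the root, output and running time -/

namespace RAM

section

variable {N : ℕ} {T : MarkedTree (Fin N)} {arr : ℕ → ℕ → ℕ} {h : Fin N → Fin N → ℕ} {s : State}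

theorem rounds_root {r : ℕ} (hr : ∀ i < r, s.arr 0 i ≠ 1) (n : ℕ) (hn : s.reg 1 + n = r) :
    Rounds rootTest rootProg s n (s.setReg 1 r) := by
  induction n generalizing s with
  | zero =>
    have : s.setReg 1 r = s := by simp [State.setReg, ← hn]
    rw [this]
    exact .refl s
  | succ n ih =>
    have hrun : rootProg.run s = s.setReg 1 (s.reg 1 + 1) := rfl
    refine .step ?_ ?_
    · simpa [rootTest, Test.holds, NatExp.eval] using hr _ (by omega)
    · have := ih (s := rootProg.run s) hr (by rw [hrun]; simp [State.setReg]; omega)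
      rw [hrun] at this ⊢
      simpa [State.setReg] using this

open Classical in
/-- The effect of `outputProg`. -/
theorem Stores.outputProg_run (hS : Stores T arr h) (hs : ∀ i < 10, s.arr i = arr i)
    {f : Fin N → ℕ} {r w : Fin N} {t : BinTree (Fin N)} (ht : T.Rooted f r w t)
    (h1 : s.reg 1 = r) (h3 : s.reg 3 = w) (hst : Holds T h s.arr r w (T.status t))
    (h10 : ∀ y : Fin N, s.arr 10 y ≠ 0 ↔ y ∈ T.selected t) :
    output N (outputProg.run s) = T.selection r t := by
  have hsp := (MarkedTree.status_spec ht).2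
  ext y
  simp only [output, Finset.mem_filter, Finset.mem_univ, true_and, MarkedTree.selection]
  generalize T.status t = st at *
  cases st with
  | empty =>
    simp only [hsp.2, Finset.notMem_empty, iff_false, not_not] at h10
    have e : outputProg.run s = s.setArr 10 r (arr 4 r) := by
      simp [outputProg, Prog.run, Test.holds, NatExp.eval, h3, show s.arr 12 w = 0 from hst, h1, hs]
    rw [e]
    by_cases hm : r ∈ T.marked
    · by_cases hy : y = r
      · simp [State.setArr, hy, (hS.marked r).1 hm, hm]
      · have hy' : (y : ℕ) ≠ r := fun e => hy (Fin.ext e)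
        simp [State.setArr, hy', hy, h10, hm]
    · by_cases hy : y = r
      · simp [State.setArr, hy, (hS.marked r).2 hm, hm]
      · have hy' : (y : ℕ) ≠ r := fun e => hy (Fin.ext e)
        simp [State.setArr, hy', h10, hm]
  | one l =>
    simp only [hsp.2, Finset.notMem_empty, iff_false, not_not] at h10
    have e : outputProg.run s = s.setArr 10 l 1 := by
      simp [outputProg, selectProg, Prog.run, Test.holds, NatExp.eval, h3, hst.1, hst.2.1]
    rw [e]
    by_cases hy : y = l
    · simp [State.setArr, hy]
    · have hy' : (y : ℕ) ≠ l := fun e => hy (Fin.ext e)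
      simp [State.setArr, hy', hy, h10]
  | many p q =>
    have e : outputProg.run s = s := by
      simp [outputProg, Prog.run, Test.holds, NatExp.eval, h3, hst.1]
    rw [e, h10]

/-- The tour meets every node but the root, so the number of nodes is linear in the number of
leaves; this bounds the search for a root. -/
theorem card_le_four_mul_leaves {f : Fin N → ℕ} {r w : Fin N} {t : BinTree (Fin N)}
    (ht : T.Rooted f r w t) (hr : (T.graph.neighborSet r).ncard = 1) :
    N ≤ 4 * T.leaves.ncard := by
  have h1 : (Finset.univ : Finset (Fin N)) ⊆ (r :: t.tour).toFinset := fun x _ => by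
    by_cases hx : x = r
    · simp [hx]
    · simp [BinTree.mem_tour, ht.mem_support_of_leaf hr hx]
  have h2 := (Finset.card_le_card h1).trans (List.toFinset_card_le _)
  have h3 := t.length_tour_add_three_le
  have h4 := ht.length_fringe_le
  simp only [Finset.card_univ, Fintype.card_fin, List.length_cons] at h2
  omega

/-- The factor in the running time of `selectionProg`. -/
def timeFactor : ℕ :=
  4 * (rootTest.cost + rootProg.bound) + 4 * (walkTest.cost + stepProg.bound) + 5 +
    outputProg.bound

/-- The program runs in linear time and returns a selection that depends on the tree only. -/
theorem Stores.exec_selectionProg (hS : Stores T arr h) :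
    ∃ (r w : Fin N) (t : BinTree (Fin N)), T.Rooted (T.graph.dist r) r w t ∧
      (T.graph.neighborSet r).ncard = 1 ∧ ∀ p : ℝ, ∃ (k : ℕ) (s : State),
        Exec selectionProg (initial N p arr) k s ∧ k ≤ timeFactor * T.leaves.ncard ∧
        output N s = T.selection r t := by
  classical
  have hex : ∃ i, ∃ v : Fin N, (v : ℕ) = i ∧ (T.graph.neighborSet v).ncard = 1 :=
    let ⟨v, hv⟩ := T.exists_leaf
    ⟨v, v, rfl, hv⟩
  -- The root is the leaf of least index, at which the first loop stops; the choice does not involve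
  -- `p`.
  obtain ⟨r, hri, hr⟩ := Nat.find_spec hex
  have hmin : ∀ i < (r : ℕ), arr 0 i ≠ 1 := fun i hi h0 =>
    Nat.find_min hex (hri ▸ hi) ⟨⟨i, hi.trans r.2⟩, rfl, by rw [← hS.degree]; exact h0⟩
  obtain ⟨w, hw, hw1, -, -⟩ := hS.nbr r
  obtain ⟨t, ht⟩ := T.exists_rooted hw
  refine ⟨r, w, t, ht, hr, fun p => ?_⟩
  have hroot := rounds_root (s := initial N p arr) hmin r (by simp [initial])
  obtain ⟨k₁, hk₁, e₁⟩ := hroot.exec trivial (by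
    simp [rootTest, Test.holds, NatExp.eval, State.setReg, initial, hS.degree, hr])
  set s₁ : State := (initial N p arr).setReg 1 r with hs₁
  set s₂ : State := (s₁.setReg 2 w).setReg 3 r with hs₂
  obtain ⟨s₃, hrounds, a, a1, a2, a3, -, ah, -, a10⟩ := hS.rounds (s := s₂) ht ht.notMem
    (fun _ _ => rfl) (by simp [hs₂, hs₁, State.setReg]) (by simp [hs₂, hs₁, State.setReg])
    (by simp [hs₂, State.setReg]) (by simp [hs₂, hs₁, State.setReg, initial])
  obtain ⟨k₃, hk₃, e₃⟩ := hrounds.exec stepProg_loopFree (by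
    simp [walkTest, Test.holds, NatExp.eval, a1, a2])
  obtain ⟨k₄, hk₄, e₄⟩ := Prog.LoopFree.exec_run (c := outputProg)
    (by simp [outputProg, selectProg, Prog.LoopFree]) s₃
  have e₂ : Exec (.assign 2 (.read 1 (.var 1))) s₁ 3 (s₁.setReg 2 w) := by
    have := Exec.assign s₁ 2 (.read 1 (.var 1))
    have hval : (NatExp.read 1 (.var 1)).eval s₁ = w := by
      simp [NatExp.eval, hs₁, State.setReg, initial, hw1]
    rwa [hval] at this
  have e₂' : Exec (.assign 3 (.var 1)) (s₁.setReg 2 w) 2 s₂ := by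
    have := Exec.assign (s₁.setReg 2 w) 3 (.var 1)
    have hval : (NatExp.var 1).eval (s₁.setReg 2 w) = r := by
      simp [NatExp.eval, hs₁, State.setReg]
    rwa [hval] at this
  refine ⟨_, _, .seq e₁ (.seq e₂ (.seq e₂' (.seq e₃ e₄))), ?_, ?_⟩
  · have hN := card_le_four_mul_leaves ht hr
    have h3 := t.length_tour_add_three_le
    have h4 := ht.length_fringe_le
    have hr4 : (r : ℕ) + 1 ≤ 4 * T.leaves.ncard := by have := r.2; omega
    have hL : t.tour.length + 1 ≤ 4 * T.leaves.ncard := by omega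
    have h5 := hk₁.trans (Nat.mul_le_mul_right _ hr4)
    have h6 := hk₃.trans (Nat.mul_le_mul_right _ hL)
    have h7 : 5 + outputProg.bound ≤ (5 + outputProg.bound) * T.leaves.ncard :=
      Nat.le_mul_of_pos_right _ (by omega)
    rw [timeFactor]
    linarith
  · exact hS.outputProg_run a ht a1 a3 ah fun y => by
      rw [a10]
      simp [hs₂, hs₁, State.setReg, initial, hS.zero]

end

end RAM

/-- The first part is the existence of the selection. The second part is the algorithm: one
program and one constant `C` for all marked trees, all ways to store them, and all `p`. -/
theorem theorem2 :
    (∀ (V : Type*) [Fintype V] (T : MarkedTree V),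
      ∃ S : Finset V, T.IsSelection S ∧ (T.marked.card : ℝ) / 10 ≤ (S.card : ℝ)) ∧
    (∃ (prog : RAM.Prog) (C : ℝ), ∀ (N : ℕ) (T : MarkedTree (Fin N)) (arr : ℕ → ℕ → ℕ)
        (h : Fin N → Fin N → ℕ), RAM.Stores T arr h →
      ∃ S : Finset (Fin N), T.IsSelection S ∧ (T.marked.card : ℝ) / 10 ≤ (S.card : ℝ) ∧
        ∀ p : ℝ, 0 < p → p < 1 →
          ∃ (k : ℕ) (s : RAM.State), RAM.Exec prog (RAM.initial N p arr) k s ∧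
            (k : ℝ) ≤ C * ((T.leaves.ncard : ℝ) / (1 - p)) ∧
            RAM.output N s ⊆ S ∧
            p * ((T.marked.card : ℝ) / 10) ≤ ((RAM.output N s).card : ℝ)) := by
  refine ⟨fun V _ T => T.exists_selection, RAM.selectionProg, RAM.timeFactor,
    fun N T arr h hS => ?_⟩
  obtain ⟨r, w, t, ht, hr, hex⟩ := hS.exec_selectionProg
  obtain ⟨h1, h2⟩ := MarkedTree.selection_spec ht hr
  have h3 : (T.marked.card : ℝ) / 10 ≤ (T.selection r t).card := by
    have : (T.marked.card : ℝ) ≤ 10 * (T.selection r t).card := by exact_mod_cast h2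
    linarith
  refine ⟨T.selection r t, h1, h3, fun p hp hp1 => ?_⟩
  obtain ⟨k, s, hexec, hk, hout⟩ := hex p
  refine ⟨k, s, hexec, ?_, hout.le, ?_⟩
  · have hk' : (k : ℝ) ≤ RAM.timeFactor * T.leaves.ncard := by exact_mod_cast hk
    refine hk'.trans (mul_le_mul_of_nonneg_left ?_ (Nat.cast_nonneg _))
    -- Dividing by `1 - p`, which is positive and at most one, only enlarges the linear bound.
    exact le_div_self (Nat.cast_nonneg _) (by linarith) (by linarith)
  · rw [hout]
    refine le_trans ?_ h3
    exact mul_le_of_le_one_left (by positivity) hp1.le
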